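/- **Theorem 5.1.** Let $w:[0,\infty)\to[0,\infty)$ be an unbounded non-decreasing function such that $\int_x^\infty \frac{w(t)}{t^3}\,dt$ is finite for $x>0$ and $$\int_x^\infty \frac{w(t)}{t^3}\,dt=O\Big(\frac{w(x)}{x^2}\Big),\qquad x\to\infty .$$ Let $\nu>-1/2$ and $p,q,\lambda>0$. Write $H_\nu f(s)=\int_0^\infty f(r)\frac{J_\nu(sr)}{(sr)^\nu}r^{2\nu+1}\,dr$ for the Hankel transform, where $J_\nu$ is the Bessel function, and let $E_{H_\nu}(p,q,\lambda,w)$ be the set of $f:(0,\infty)\to\mathbb C$ in $L^1\cap L^2$ of the measure $r^{2\nu+1}dr$ for which there is a constant $C$ with $$|f(r)|\le C e^{-\frac{pr^2}{2}+\lambda w(qr)},\qquad |H_\nu f(s)|\le C e^{-\frac{ps^2}{2}+\lambda w(qs)}\qquad\text{for a.e. } r,s>0. \tag{$*$}$$ Let $\psi_k^\nu(r)=L_k^\nu(r^2)e^{-r^2/2}$, where $L_k^\nu$ is the Laguerre polynomial of degree $k$ and type $\nu$, and $\langle f,\psi_k^\nu\rangle=\int_0^\infty f(r)\psi_k^\nu(r)r^{2\nu+1}\,dr$.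 For $\phi:\mathbb R\to\mathbb R$ let $\phi^*(v)=\sup_{u\ge0}\,[uv-\phi(u)]\in(-\infty,+\infty]$ for $v\ge 0$ be its Young conjugate, with the convention $e^{-\infty}=0$, and let $\varphi(t)=w(e^t)$. 1. There are $l>0$ and $K>0$, depending only on $\nu,\lambda,q,w$, such that for all $p\ge1$, all $f\in E_{H_\nu}(p,q,\lambda,w)$, every $C$ for which $(*)$ holds, and all integers $k\ge0$, $$|\langle f,\psi_k^\nu\rangle|\le K\,C\,2^{2k}\,\Gamma(k+\nu+1)\,e^{2k\log q-\frac1l\varphi^*(2lk)} .$$ 2. There are $l>0$ and $K>0$, depending only on $\nu,\lambda,q,w$, such that for all $0<p<1$, all $f\in E_{H_\nu}(p,q,\lambda,w)$, every $C$ for which $(*)$ holds, and all integers $k\ge0$, $$|\langle f,\psi_k^\nu\rangle|\le K\,C\,2^{2k}\,\Gamma(k+\nu+1)\,e^{2k\log q-\frac1l\zeta_{p,q}^*(2lk)},\qquad \zeta_{p,q}(t)=\frac1{4q^2}\sqrt{\frac{1-p}{1+p}}\,e^{2t}+w(e^t).$$ -/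

import Mathlib

open MeasureTheory Set Filter Asymptotics

namespace HankelHardy

noncomputable section

/-- Weight functions: unbounded non-decreasing functions `w : [0, ∞) → [0, ∞)`.
Only the values of `w` on `[0, ∞)` matter. -/
structure IsWeight (w : ℝ → ℝ) : Prop where
  nonneg : ∀ t, 0 ≤ t → 0 ≤ w t
  mono : MonotoneOn w (Ici 0)
  unbounded : ∀ M : ℝ, ∃ t, 0 ≤ t ∧ M < w t

/-- The standing growth condition `∫_x^∞ w(t) / t³ dt = O(w(x) / x²)` as `x → ∞`;
the finiteness of the integrals is part of the condition. -/
def GrowthCondition (w : ℝ → ℝ) : Prop :=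
  (∀ x : ℝ, 0 < x → IntegrableOn (fun t => w t / t ^ 3) (Ioi x)) ∧
    (fun x : ℝ => ∫ t in Ioi x, w t / t ^ 3) =O[atTop] (fun x : ℝ => w x / x ^ 2)

/-- The Young conjugate `φ*(v) = sup_{u ≥ 0} (u v - φ(u))`, with values in the extended reals:
it is `+∞` where the supremum is not finite. -/
def youngConj (φ : ℝ → ℝ) (v : ℝ) : EReal :=
  ⨆ u : ℝ, ⨆ _ : 0 ≤ u, ((u * v - φ u : ℝ) : EReal)

/-- `φ(t) = w(e^t)`. -/
def phi (w : ℝ → ℝ) (t : ℝ) : ℝ := w (Real.exp t)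

/-- `ζ_{p,q}(t) = (1 / (4 q²)) √((1 - p) / (1 + p)) e^{2t} + w(e^t)`. -/
def zeta (w : ℝ → ℝ) (p q : ℝ) (t : ℝ) : ℝ :=
  1 / (4 * q ^ 2) * Real.sqrt ((1 - p) / (1 + p)) * Real.exp (2 * t) + w (Real.exp t)

/-- The measure `r^{2ν+1} dr` on `ℝ⁺ = (0, ∞)`. -/
def muNu (ν : ℝ) : Measure ℝ :=
  (volume.restrict (Ioi (0 : ℝ))).withDensity (fun r => ENNReal.ofReal (r ^ (2 * ν + 1)))

/-- The Bessel function
`J_ν(z) = (z/2)^ν / (Γ(ν + 1/2) Γ(1/2)) ∫_{-1}^{1} e^{izs} (1 - s²)^{ν - 1/2} ds`, `ν > -1/2`. -/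
def besselJ (ν : ℝ) (z : ℂ) : ℂ :=
  (z / 2) ^ (ν : ℂ) / ((Real.Gamma (ν + 1 / 2) * Real.Gamma (1 / 2) : ℝ) : ℂ) *
    ∫ s in (-1 : ℝ)..1, Complex.exp (Complex.I * z * s) * (((1 - s ^ 2) ^ (ν - 1 / 2) : ℝ) : ℂ)

/-- The Hankel transform `H_ν f(s) = ∫_0^∞ f(r) J_ν(sr) / (sr)^ν r^{2ν+1} dr`, `s > 0`. -/
def hankel (ν : ℝ) (f : ℝ → ℂ) (s : ℝ) : ℂ :=
  ∫ r in Ioi (0 : ℝ),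
    f r * (besselJ ν ((s * r : ℝ) : ℂ) / (((s * r) ^ ν : ℝ) : ℂ)) * ((r ^ (2 * ν + 1) : ℝ) : ℂ)

/-- The Laguerre polynomial of degree `k` and type `ν`,
`L_k^ν(x) = ∑_{i ≤ k} (-1)^i Γ(k+ν+1) / ((k-i)! Γ(ν+i+1)) x^i / i!`, which is the coefficient of
`r^k` in `(1 - r)^{-ν-1} e^{-xr/(1-r)}`. -/
def laguerre (ν : ℝ) (k : ℕ) (x : ℝ) : ℝ :=
  ∑ i ∈ Finset.range (k + 1),
    (-1) ^ i * Real.Gamma (k + ν + 1) / ((k - i).factorial * Real.Gamma (ν + i + 1)) *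
      (x ^ i / i.factorial)

/-- The Laguerre function `ψ_k^ν(s) = L_k^ν(s²) e^{-s²/2}`. -/
def psi (ν : ℝ) (k : ℕ) (s : ℝ) : ℝ :=
  laguerre ν k (s ^ 2) * Real.exp (-s ^ 2 / 2)

/-- The Laguerre coefficient `⟨f, ψ_k^ν⟩ = ∫_0^∞ f(r) ψ_k^ν(r) r^{2ν+1} dr`. -/
def laguerreCoeff (ν : ℝ) (f : ℝ → ℂ) (k : ℕ) : ℂ :=
  ∫ r in Ioi (0 : ℝ), f r * (psi ν k r : ℂ) * ((r ^ (2 * ν + 1) : ℝ) : ℂ)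

/-- `|f(r)| ≤ C e^{-p r² / 2 + lam w(q r)}` for almost every `r > 0`. -/
def GaussBound (p q lam : ℝ) (w : ℝ → ℝ) (C : ℝ) (f : ℝ → ℂ) : Prop :=
  ∀ᵐ r ∂(volume.restrict (Ioi (0 : ℝ))),
    ‖f r‖ ≤ C * Real.exp (-(p * r ^ 2) / 2 + lam * w (q * r))

/-- The weighted Hardy class `E_{H_ν}(p, q, lam, w)`: functions in `L¹ ∩ L²` of `r^{2ν+1} dr` such
that `f` and `H_ν f` both satisfy the Gaussian bound with some constant. -/
def hardyClass (ν p q lam : ℝ) (w : ℝ → ℝ) : Set (ℝ → ℂ) :=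
  {f | MemLp f 1 (muNu ν) ∧ MemLp f 2 (muNu ν) ∧
    ∃ C : ℝ, GaussBound p q lam w C f ∧ GaussBound p q lam w C (hankel ν f)}

/-- The right-hand side `2^{2k} Γ(k+ν+1) e^{2k log q - (1/l) φ*(2lk)}` with `e^{-∞} = 0`. -/
def decayBound (ν q l : ℝ) (φ : ℝ → ℝ) (k : ℕ) : ENNReal :=
  ENNReal.ofReal (2 ^ (2 * k) * Real.Gamma (k + ν + 1)) *
    EReal.exp (((2 * k * Real.log q : ℝ) : EReal) -
      ((1 / l : ℝ) : EReal) * youngConj φ (2 * l * k))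

end

end HankelHardy

/-! The proof packs the Laguerre coefficients of `f` into the entire function g(t) = ∑ ⟨f, ψ_k⟩ t^k
/ Γ(k+ν+1) and bounds g on circles; Cauchy's estimates then bound the coefficients. Since ∑ L_k(x)
t^k / Γ(k+ν+1) is e^t times the Bessel–Clifford function at -xt, g(t) is an explicit integral of `f`
against a Bessel kernel with a Gaussian. The Laguerre functions are eigenfunctions of the Hankel
transform with eigenvalue (-1)^k (`laguerreCoeff_hankel`), so g(-t) is the same integral for `hankel
ν f`, and the two hypotheses control g from two opposite sides.

The growth condition makes w regular of order below two (`GrowthCondition.exists_power_bound`): w(t)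
is at most a constant times (1 + w(x))(1 + (t/x)^{2β}) with β < 1. Hence the factor e^{λw} only
perturbs Gaussian estimates by a term of smaller order. With a = (1-p)/(1+p), Weber's integral gives
(`norm_integral_generating_le`) log|g(t)| ≤ ((|t| + Re t) + a(|t| - Re t))/2 up to D(1 + (|t|/T)^β)
and a constant; the same holds with t replaced by -t.

Near the imaginary axis these bounds are only about (1+a)|t|/2, which is not small when p is near 1.
A Phragmén–Lindelöf argument in a sector around that axis (`norm_le_of_entire`) improves this to √a
|t|, uniformly in p. On the circle of radius T = ρ²/4 the perturbation is of size 1 + w(qρ).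

Finally ρ = e^u/q with u ≥ 0 free; the best u produces the Young conjugate (`ofReal_le_decayBound`).
For p < 1 the term √a T is the exponential part of ζ. For p ≥ 1 the hypotheses hold for every p' <
1, and since the constants do not depend on p', letting p' → 1 removes that term. -/

namespace HankelHardy

/-! ### Regular growth of the weight -/

/-- The tail integral at least halves its decay at each dyadic step. -/
theorem tail_integral_two_mul_le {w : ℝ → ℝ} (hw : IsWeight w)
    (hi : ∀ x : ℝ, 0 < x → IntegrableOn (fun t => w t / t ^ 3) (Ioi x))
    {A x₀ : ℝ} (hA : 0 < A) (hx₀ : 0 < x₀)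
    (hb : ∀ x, x₀ ≤ x → ∫ t in Ioi x, w t / t ^ 3 ≤ A * (w x / x ^ 2)) {x : ℝ} (hx : x₀ ≤ x) :
    (1 + 1 / (2 * A)) * (∫ t in Ioi (2 * x), w t / t ^ 3) ≤ ∫ t in Ioi x, w t / t ^ 3 := by
  have hx0 : 0 < x := hx₀.trans_le hx
  set H := ∫ t in Ioi (2 * x), w t / t ^ 3 with hH
  have hsplit : (∫ t in Ioc x (2 * x), w t / t ^ 3) + H = ∫ t in Ioi x, w t / t ^ 3 := by
    rw [hH, ← setIntegral_union (by
      rw [Set.disjoint_left]; intro t ht ht'; exact absurd ht.2 (not_le.mpr ht'))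
      measurableSet_Ioi ((hi x hx0).mono_set Ioc_subset_Ioi_self)
      ((hi x hx0).mono_set (Ioi_subset_Ioi (by linarith))), Ioc_union_Ioi_eq_Ioi (by linarith)]
  -- The growth condition read backwards: the integrand at s is at least the tail from s divided by
  -- As, and for s ≤ 2x that tail contains the tail from 2x.
  have hpt : ∀ s ∈ Ioc x (2 * x), H / (2 * A * x) ≤ w s / s ^ 3 := by
    intro s hs
    have hs0 : 0 < s := hx0.trans hs.1
    have h1 : H ≤ ∫ t in Ioi s, w t / t ^ 3 := by
      refine setIntegral_mono_set (hi s hs0) ?_ (Ioi_subset_Ioi hs.2).eventuallyLE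
      filter_upwards [ae_restrict_mem measurableSet_Ioi] with t ht
      have : 0 < t := hs0.trans ht
      exact div_nonneg (hw.nonneg t this.le) (by positivity)
    have h2 := h1.trans (hb s (hx.trans hs.1.le))
    have hws := hw.nonneg s hs0.le
    rw [div_le_div_iff₀ (by positivity) (by positivity)]
    rw [← mul_div_assoc, le_div_iff₀ (by positivity)] at h2
    have h3 : H * s ^ 3 = (H * s ^ 2) * s := by ring
    rw [h3]
    calc H * s ^ 2 * s ≤ (A * w s) * s := by gcongr
      _ ≤ (A * w s) * (2 * x) := by
        have := hs.2
        gcongr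
      _ = w s * (2 * A * x) := by ring
  have hlow : H / (2 * A) ≤ ∫ t in Ioc x (2 * x), w t / t ^ 3 := by
    have := setIntegral_mono_on (μ := volume) (f := fun _ => H / (2 * A * x))
      (integrableOn_const (by simp)) ((hi x hx0).mono_set Ioc_subset_Ioi_self)
      measurableSet_Ioc hpt
    refine le_trans (le_of_eq ?_) this
    simp only [integral_const, MeasurableSet.univ, measureReal_restrict_apply, univ_inter,
      Real.volume_real_Ioc_of_le (show x ≤ 2 * x by linarith), smul_eq_mul]
    field_simp
    ring
  have : (1 + 1 / (2 * A)) * H = H / (2 * A) + H := by ring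
  linarith

/-- Monotonicity bounds the integrand on (x, 2x] from below by w(x)/(2x)³. This turns decay of the
tail integral back into a bound on w. -/
theorem weight_le_tail_integral {w : ℝ → ℝ} (hw : IsWeight w)
    (hi : ∀ x : ℝ, 0 < x → IntegrableOn (fun t => w t / t ^ 3) (Ioi x)) {x : ℝ} (hx : 0 < x) :
    w x / (8 * x ^ 2) ≤ ∫ t in Ioi x, w t / t ^ 3 := by
  have hpt : ∀ s ∈ Ioc x (2 * x), w x / (2 * x) ^ 3 ≤ w s / s ^ 3 := by
    intro s hs
    have hs0 : 0 < s := hx.trans hs.1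
    have := hw.nonneg x hx.le
    have := hs.2
    have := hw.mono hx.le hs0.le hs.1.le
    have := hw.nonneg s hs0.le
    gcongr
  have h1 := setIntegral_mono_on (μ := volume) (f := fun _ => w x / (2 * x) ^ 3)
      (integrableOn_const (by simp)) ((hi x hx).mono_set Ioc_subset_Ioi_self)
      measurableSet_Ioc hpt
  have h2 : ∫ t in Ioc x (2 * x), w t / t ^ 3 ≤ ∫ t in Ioi x, w t / t ^ 3 := by
    refine setIntegral_mono_set (hi x hx) ?_ Ioc_subset_Ioi_self.eventuallyLE
    filter_upwards [ae_restrict_mem measurableSet_Ioi] with t ht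
    have : 0 < t := hx.trans ht
    exact div_nonneg (hw.nonneg t this.le) (by positivity)
  refine le_trans (le_of_eq ?_) (h1.trans h2)
  simp only [integral_const, MeasurableSet.univ, measureReal_restrict_apply, univ_inter,
      Real.volume_real_Ioc_of_le (show x ≤ 2 * x by linarith), smul_eq_mul]
  field_simp
  ring

/-- The growth condition forces regular growth of order less than two. -/
theorem GrowthCondition.exists_power_bound {w : ℝ → ℝ} (hw : IsWeight w)
    (hg : GrowthCondition w) :
    ∃ A β : ℝ, 0 < A ∧ 0 < β ∧ β < 1 ∧ ∀ x t : ℝ, 1 ≤ x → 0 ≤ t →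
      w t ≤ A * (1 + w x) * (1 + ((t / x) ^ 2) ^ β) := by
  obtain ⟨hi, hO⟩ := hg
  obtain ⟨A₀, hA₀, hO⟩ := hO.exists_pos
  obtain ⟨x₁, hx₁⟩ := eventually_atTop.mp hO.bound
  set x₀ := max x₁ 1 with hx₀def
  have hx₀1 : 1 ≤ x₀ := le_max_right _ _
  have hx₀ : 0 < x₀ := by linarith
  have hb : ∀ x, x₀ ≤ x → ∫ t in Ioi x, w t / t ^ 3 ≤ A₀ * (w x / x ^ 2) := by
    intro x hx
    have hx0 : 0 < x := hx₀.trans_le hx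
    have h := hx₁ x ((le_max_left _ _).trans hx)
    rw [Real.norm_eq_abs, Real.norm_eq_abs,
      abs_of_nonneg (div_nonneg (hw.nonneg x hx0.le) (by positivity))] at h
    exact (le_abs_self _).trans h
  set κ := 1 + 1 / (2 * A₀) with hκ
  have hκ1 : 1 < κ := by rw [hκ]; have : 0 < 1 / (2 * A₀) := by positivity
                         linarith
  have hiter : ∀ (n : ℕ) (x : ℝ), x₀ ≤ x →
      κ ^ n * (∫ t in Ioi (2 ^ n * x), w t / t ^ 3) ≤ ∫ t in Ioi x, w t / t ^ 3 := by
    intro n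
    induction n with
    | zero => intro x _; simp
    | succ n ih =>
      intro x hx
      have h1 := tail_integral_two_mul_le hw hi hA₀ hx₀ hb (x := 2 ^ n * x)
        (hx.trans (le_mul_of_one_le_left (by linarith) (one_le_pow₀ (by norm_num))))
      have h2 := ih x hx
      have e : (2 : ℝ) ^ (n + 1) * x = 2 * (2 ^ n * x) := by ring
      rw [e, pow_succ, mul_assoc]
      refine le_trans ?_ h2
      exact mul_le_mul_of_nonneg_left h1 (by positivity)
  -- The second entry is the exponent with 4^β = 4/κ, the growth of w per doubling; it is below 1
  -- because κ > 1. The maximum with 1/2 keeps β positive when κ is large.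
  set β := max (1 / 2) (1 - Real.log κ / Real.log 4) with hβ
  have hl4 : 0 < Real.log 4 := Real.log_pos (by norm_num)
  have hβ0 : 0 < β := lt_of_lt_of_le (by norm_num) (le_max_left _ _)
  have hβ1 : β < 1 := by
    rw [hβ, max_lt_iff]
    refine ⟨by norm_num, ?_⟩
    have := div_pos (Real.log_pos hκ1) hl4
    linarith
  have h4β : 4 / κ ≤ (4 : ℝ) ^ β := by
    have h1 : (4 : ℝ) ^ (1 - Real.log κ / Real.log 4) = 4 / κ := by
      rw [Real.rpow_sub (by norm_num), Real.rpow_one,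
        Real.rpow_def_of_pos (by norm_num : (0 : ℝ) < 4), mul_div_cancel₀ _ hl4.ne',
        Real.exp_log (by linarith)]
    rw [← h1]
    exact Real.rpow_le_rpow_of_exponent_le (by norm_num) (le_max_right _ _)
  have hdy : ∀ (n : ℕ) (x : ℝ), x₀ ≤ x → w (2 ^ n * x) ≤ 8 * A₀ * ((4 : ℝ) ^ β) ^ n * w x := by
    intro n x hx
    have hx0 : 0 < x := hx₀.trans_le hx
    have h1 := weight_le_tail_integral hw hi (x := 2 ^ n * x) (by positivity)
    have h2 := (mul_le_mul_of_nonneg_left h1 (by positivity : (0 : ℝ) ≤ κ ^ n)).trans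
      ((hiter n x hx).trans (hb x hx))
    have hwx := hw.nonneg x hx0.le
    calc w (2 ^ n * x) = (κ ^ n * (w (2 ^ n * x) / (8 * (2 ^ n * x) ^ 2))) *
          (8 * x ^ 2 * (4 / κ) ^ n) := by
          have : ((2 : ℝ) ^ n) ^ 2 = 4 ^ n := by rw [← pow_mul, mul_comm, pow_mul]; norm_num
          rw [mul_pow, this, div_pow]
          have : κ ≠ 0 := by positivity
          field_simp
      _ ≤ (A₀ * (w x / x ^ 2)) * (8 * x ^ 2 * (4 / κ) ^ n) :=
          mul_le_mul_of_nonneg_right h2 (by positivity)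
      _ = 8 * A₀ * (4 / κ) ^ n * w x := by field_simp
      _ ≤ 8 * A₀ * ((4 : ℝ) ^ β) ^ n * w x := by gcongr
  have hlarge : ∀ x t : ℝ, x₀ ≤ x → x ≤ t → w t ≤ 32 * A₀ * ((t / x) ^ 2) ^ β * w x := by
    intro x t hx ht
    have hx0 : 0 < x := hx₀.trans_le hx
    obtain ⟨n, hn1, hn2⟩ := exists_nat_pow_near ((one_le_div hx0).mpr ht)
      (by norm_num : (1 : ℝ) < 2)
    have hwx := hw.nonneg x hx0.le
    have h1 : w t ≤ w (2 ^ (n + 1) * x) :=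
      hw.mono (by simp; linarith) (by simp; positivity) ((div_lt_iff₀ hx0).mp hn2).le
    refine h1.trans ((hdy (n + 1) x hx).trans ?_)
    have h3 : ((4 : ℝ) ^ β) ^ n ≤ ((t / x) ^ 2) ^ β := by
      rw [← Real.rpow_natCast, ← Real.rpow_mul (by norm_num), mul_comm β, Real.rpow_mul (by norm_num),
        Real.rpow_natCast]
      refine Real.rpow_le_rpow (by positivity) ?_ hβ0.le
      calc (4 : ℝ) ^ n = (2 ^ n) ^ 2 := by rw [← pow_mul, mul_comm n, pow_mul]; norm_num
        _ ≤ _ := by gcongr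
    have h4 : (4 : ℝ) ^ β ≤ 4 := by
      calc (4 : ℝ) ^ β ≤ 4 ^ (1 : ℝ) :=
            Real.rpow_le_rpow_of_exponent_le (by norm_num) hβ1.le
        _ = 4 := by simp
    rw [pow_succ]
    calc 8 * A₀ * (((4 : ℝ) ^ β) ^ n * 4 ^ β) * w x
        ≤ 8 * A₀ * (((t / x) ^ 2) ^ β * 4) * w x := by gcongr
      _ = _ := by ring
  have hwx₀ := hw.nonneg x₀ hx₀.le
  -- The factor 1 + w(x₀) covers the range 1 ≤ x ≤ x₀, where the asymptotic condition says nothing.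
  refine ⟨(1 + 32 * A₀) * (1 + w x₀), β, by positivity, hβ0, hβ1, fun x t hx ht => ?_⟩
  have hx0 : 0 < x := by linarith
  have hwx := hw.nonneg x hx0.le
  have hP : 0 ≤ ((t / x) ^ 2) ^ β := by positivity
  set P := ((t / x) ^ 2) ^ β
  rcases le_total t x with htx | htx
  · have h1 := hw.mono (by simpa using ht) (by simp; linarith) htx
    calc w t ≤ 1 * (1 + w x) * 1 := by linarith
      _ ≤ _ := by
        gcongr
        · nlinarith
        · linarith
  rcases le_total x₀ x with h0 | h0
  · have h1 := hlarge x t h0 htx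
    calc w t ≤ (32 * A₀) * w x * P := by linarith
      _ ≤ ((1 + 32 * A₀) * (1 + w x₀)) * (1 + w x) * (1 + P) := by
        have : 32 * A₀ ≤ (1 + 32 * A₀) * (1 + w x₀) := by nlinarith
        gcongr ?_ * ?_ * ?_ <;> linarith
  rcases le_total t x₀ with h1 | h1
  · have h2 := hw.mono (by simpa using ht) (by simp; linarith) h1
    calc w t ≤ (1 * (1 + w x₀)) * 1 * 1 := by linarith
      _ ≤ _ := by
        gcongr <;> linarith
  · have h2 := hlarge x₀ t le_rfl h1
    have h3 : ((t / x₀) ^ 2) ^ β ≤ P := by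
      refine Real.rpow_le_rpow (by positivity) ?_ hβ0.le
      gcongr
    calc w t ≤ (32 * A₀ * P) * w x₀ :=
          h2.trans (by gcongr)
      _ = (32 * A₀ * w x₀) * 1 * P := by ring
      _ ≤ _ := by
        have : 32 * A₀ * w x₀ ≤ (1 + 32 * A₀) * (1 + w x₀) := by nlinarith
        gcongr ?_ * ?_ * ?_ <;> linarith

/-! ### Phragmén–Lindelöf estimates -/

/-- A Phragmén–Lindelöf principle in a sector for a function whose growth on the sides is controlled
by a linear term and a term of smaller order. -/
theorem norm_le_of_sector {g : ℂ → ℂ} (hg : Differentiable ℂ g) {M T D α β ψ : ℝ} (hT : 0 < T)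
    (hD : 0 ≤ D) (hβ0 : 0 < β) (hβ1 : β < 1) (hα : 0 ≤ α) (hM : 0 ≤ M)
    (hψ0 : 0 < ψ) (hψ : ψ < Real.pi / 2)
    (hgrow : ∀ u : ℂ, ‖g u‖ ≤ M * Real.exp (‖u‖ + D * (1 + (‖u‖ / T) ^ β)))
    (hside : ∀ r θ : ℝ, 0 < r → |θ| = ψ → ‖g (r * Complex.exp (θ * Complex.I))‖ ≤
      M * Real.exp (α * (r * Real.cos θ) + D * (1 + (r / T) ^ β)))
    {θ : ℝ} (hθ : |θ| ≤ ψ) :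
    ‖g (T * Complex.exp (θ * Complex.I))‖ ≤
      M * Real.exp (α * T + D + D / Real.cos (β * (Real.pi / 2))) := by
  set γ := Real.cos (β * (Real.pi / 2)) with hγ
  have hpi := Real.pi_pos
  have hγ0 : 0 < γ := Real.cos_pos_of_mem_Ioo ⟨by nlinarith, by nlinarith⟩
  have hcosβ : ∀ s : ℝ, |s| ≤ ψ → γ ≤ Real.cos (β * s) := by
    intro s hs
    rw [hγ, ← Real.cos_abs (β * s)]
    refine Real.cos_le_cos_of_nonneg_of_le_pi (abs_nonneg _) (by nlinarith) ?_
    rw [abs_mul, abs_of_pos hβ0]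
    gcongr
    linarith
  have hcos : ∀ s : ℝ, |s| ≤ ψ → 0 ≤ Real.cos s := fun s hs =>
    Real.cos_nonneg_of_mem_Icc ⟨by linarith [(abs_le.mp hs).1], by linarith [(abs_le.mp hs).2]⟩
  -- In the variable u = e^ζ the sector becomes a strip and the multiplier is exp(-αu -
  -- (D/γ)(u/T)^β). Dividing by γ makes the real part of the last term dominate D(|u|/T)^β in the
  -- whole sector, so only the constant MeᴰD-free bound `M * Real.exp D` remains on the edges.
  set E : ℂ → ℂ := fun ζ => -(α * Complex.exp ζ) -
    (D / γ : ℝ) * Complex.exp (β * (ζ - Real.log T)) with hE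
  set F : ℂ → ℂ := fun ζ => g (Complex.exp ζ) * Complex.exp (E ζ) with hF
  have hEre : ∀ ζ : ℂ, (E ζ).re = -(α * (Real.exp ζ.re * Real.cos ζ.im)) -
      D / γ * ((Real.exp ζ.re / T) ^ β * Real.cos (β * ζ.im)) := by
    intro ζ
    have h1 : (Real.exp ζ.re / T) ^ β = Real.exp (β * (ζ.re - Real.log T)) := by
      rw [Real.rpow_def_of_pos (by positivity), Real.log_div (by positivity) hT.ne', Real.log_exp,
        mul_comm]
    simp only [hE, Complex.sub_re, Complex.neg_re, Complex.re_ofReal_mul, Complex.exp_re, h1,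
      Complex.im_ofReal_mul, Complex.ofReal_re, Complex.sub_im, Complex.ofReal_im, sub_zero]
  have hexp : ∀ ζ : ℂ, Complex.exp ζ = (Real.exp ζ.re : ℝ) * Complex.exp (ζ.im * Complex.I) := by
    intro ζ
    rw [Complex.ofReal_exp, ← Complex.exp_add, Complex.re_add_im]
  have hFn : ∀ ζ, ‖F ζ‖ = ‖g (Complex.exp ζ)‖ * Real.exp (E ζ).re := by
    intro ζ; rw [hF, norm_mul, Complex.norm_exp]
  have hFd : Differentiable ℂ F := by
    rw [hF, hE]
    exact (hg.comp Complex.differentiable_exp).mul (by fun_prop)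
  have hends : ∀ ζ : ℂ, |ζ.im| = ψ → ‖F ζ‖ ≤ M * Real.exp D := by
    intro ζ hζ
    rw [hFn, hEre]
    have h1 := hside (Real.exp ζ.re) ζ.im (Real.exp_pos _) hζ
    rw [← hexp] at h1
    refine (mul_le_mul_of_nonneg_right h1 (Real.exp_pos _).le).trans ?_
    rw [mul_assoc, ← Real.exp_add]
    gcongr
    set P := (Real.exp ζ.re / T) ^ β
    have hP : 0 ≤ P := by positivity
    have h2 : D * P ≤ D / γ * (P * Real.cos (β * ζ.im)) := by
      calc D * P = D / γ * (P * γ) := by field_simp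
        _ ≤ _ := by gcongr; exact hcosβ _ hζ.le
    linarith
  have hO : F =O[comap (_root_.abs ∘ Complex.re) atTop ⊓ 𝓟 (Complex.im ⁻¹' Ioo (-ψ) ψ)]
      fun z ↦ Real.exp ((1 + D * (1 / T + 2)) * Real.exp (1 * |z.re|)) := by
    refine IsBigO.of_bound M ?_
    filter_upwards [mem_inf_of_right (mem_principal_self _)] with ζ hζ
    have hζ' : |ζ.im| ≤ ψ := abs_le.mpr ⟨hζ.1.le, hζ.2.le⟩
    rw [hFn, Real.norm_of_nonneg (Real.exp_pos _).le, one_mul]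
    have h1 : (E ζ).re ≤ 0 := by
      rw [hEre]
      have := hcos _ hζ'
      have := hγ0.le.trans (hcosβ _ hζ')
      have : 0 ≤ α * (Real.exp ζ.re * Real.cos ζ.im) := by positivity
      have : 0 ≤ D / γ * ((Real.exp ζ.re / T) ^ β * Real.cos (β * ζ.im)) := by positivity
      linarith
    have h2 := hgrow (Complex.exp ζ)
    rw [Complex.norm_exp] at h2
    have h3 : Real.exp ζ.re ≤ Real.exp |ζ.re| := Real.exp_le_exp.mpr (le_abs_self _)
    have h4 : 1 ≤ Real.exp |ζ.re| := Real.one_le_exp (abs_nonneg _)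
    set R := Real.exp |ζ.re|
    have h5 : (Real.exp ζ.re / T) ^ β ≤ 1 + R / T := by
      calc (Real.exp ζ.re / T) ^ β ≤ (1 + R / T) ^ β := by
            refine Real.rpow_le_rpow (by positivity) ?_ hβ0.le
            have : Real.exp ζ.re / T ≤ R / T := by gcongr
            linarith
        _ ≤ (1 + R / T) ^ (1 : ℝ) := Real.rpow_le_rpow_of_exponent_le
            (by have : 0 < R / T := by positivity
                linarith) hβ1.le
        _ = _ := Real.rpow_one _
    calc ‖g (Complex.exp ζ)‖ * Real.exp (E ζ).re ≤ ‖g (Complex.exp ζ)‖ * 1 := by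
          gcongr; exact Real.exp_le_one_iff.mpr h1
      _ ≤ _ := by
          rw [mul_one]
          refine h2.trans ?_
          gcongr
          calc Real.exp ζ.re + D * (1 + (Real.exp ζ.re / T) ^ β) ≤
              R + D * (R + (R + R / T)) := by
                gcongr
                linarith
            _ = _ := by ring
  -- The strip has width 2ψ < π, so growth like exp(B e^{|Re ζ|}), that is exponential type in u, is
  -- admissible: 1 < π/(2ψ).
  have hPL := PhragmenLindelof.horizontal_strip (f := F) (C := M * Real.exp D) (a := -ψ) (b := ψ)
    (z := Real.log T + θ * Complex.I) hFd.diffContOnCl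
    ⟨1, by rw [lt_div_iff₀ (by linarith)]; linarith, _, hO⟩
    (fun z hz => hends z (by rw [hz, abs_neg, abs_of_pos hψ0]))
    (fun z hz => hends z (by rw [hz, abs_of_pos hψ0]))
    (by simpa using (abs_le.mp hθ).1) (by simpa using (abs_le.mp hθ).2)
  rw [hFn, hEre, hexp] at hPL
  simp only [Complex.add_re, Complex.ofReal_re, Complex.mul_re, Complex.I_re, mul_zero,
    Complex.ofReal_im, Complex.I_im, mul_one, sub_self, add_zero, Complex.add_im, Complex.mul_im,
    zero_add, Real.exp_log hT, div_self hT.ne', Real.one_rpow, one_mul] at hPL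
  have hfin : ‖g (T * Complex.exp (θ * Complex.I))‖ ≤ M * Real.exp D *
      Real.exp (α * (T * Real.cos θ) + D / γ * Real.cos (β * θ)) := by
    rw [← div_le_iff₀ (Real.exp_pos _), div_eq_mul_inv, ← Real.exp_neg, neg_add, ← sub_eq_add_neg]
    exact hPL
  refine hfin.trans ?_
  rw [mul_assoc, ← Real.exp_add]
  refine mul_le_mul_of_nonneg_left (Real.exp_le_exp.mpr ?_) hM
  have h1 : α * (T * Real.cos θ) ≤ α * (T * 1) := by gcongr; exact Real.cos_le_one _
  have h2 : D / γ * Real.cos (β * θ) ≤ D / γ * 1 := by gcongr; exact Real.cos_le_one _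
  linarith

/-- The half-plane is centred on the positive imaginary axis. The sector is chosen so that on its
two sides the better of the two hypotheses equals √a times the distance along the axis;
Phragmén–Lindelöf carries this inside. Outside the sector the better hypothesis is already strong
enough. -/
theorem norm_le_of_half_plane {g : ℂ → ℂ} (hg : Differentiable ℂ g) {M T D a β : ℝ} (hT : 0 < T)
    (hD : 0 ≤ D) (hβ0 : 0 < β) (hβ1 : β < 1) (ha0 : 0 < a) (ha1 : a < 1) (hM : 0 ≤ M)
    (h1 : ∀ t : ℂ, ‖g t‖ ≤ M * Real.exp (((‖t‖ + t.re) + a * (‖t‖ - t.re)) / 2 +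
      D * (1 + (‖t‖ / T) ^ β)))
    (h2 : ∀ t : ℂ, ‖g t‖ ≤ M * Real.exp (((‖t‖ - t.re) + a * (‖t‖ + t.re)) / 2 +
      D * (1 + (‖t‖ / T) ^ β)))
    {θ : ℝ} (hθ : |θ| ≤ Real.pi / 2) :
    ‖g (T * Complex.exp (θ * Complex.I) * Complex.I)‖ ≤
      M * Real.exp (Real.sqrt a * T + D * (2 + 1 / Real.cos (β * (Real.pi / 2)))) := by
  have hpi := Real.pi_pos
  have hγ0 : 0 < Real.cos (β * (Real.pi / 2)) :=
    Real.cos_pos_of_mem_Ioo ⟨by nlinarith, by nlinarith⟩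
  -- At sin θ = s₀ the linear exponent (r(1-s₀) + a r(1+s₀))/2 is 2ar/(1+a), while cos ψ =
  -- 2√a/(1+a); so it equals √a · r cos ψ exactly.
  set s₀ := (1 - a) / (1 + a) with hs₀
  have hs0 : 0 < s₀ := div_pos (by linarith) (by linarith)
  have hs1 : s₀ < 1 := by rw [hs₀, div_lt_one (by linarith)]; linarith
  set ψ := Real.arcsin s₀ with hψ
  have hψ0 : 0 < ψ := Real.arcsin_pos.mpr hs0
  have hψ1 : ψ < Real.pi / 2 := Real.arcsin_lt_pi_div_two.mpr hs1
  have hsin : Real.sin ψ = s₀ := Real.sin_arcsin (by linarith) hs1.le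
  have hsq : Real.sqrt a ^ 2 = a := Real.sq_sqrt ha0.le
  have hsq0 : 0 < Real.sqrt a := Real.sqrt_pos.mpr ha0
  have hcosψ : Real.cos ψ = 2 * Real.sqrt a / (1 + a) := by
    rw [hψ, Real.cos_arcsin, Real.sqrt_eq_iff_mul_self_eq_of_pos (by positivity), hs₀]
    have : (1 + a) ≠ 0 := by linarith
    field_simp
    linear_combination (4 : ℝ) * hsq
  have hnorm : ∀ r θ : ℝ, 0 ≤ r → ‖(r : ℂ) * Complex.exp (θ * Complex.I) * Complex.I‖ = r := by
    intro r θ hr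
    rw [norm_mul, norm_mul, Complex.norm_exp_ofReal_mul_I, Complex.norm_I, mul_one, mul_one,
      Complex.norm_of_nonneg hr]
  have hre : ∀ r θ : ℝ, ((r : ℂ) * Complex.exp (θ * Complex.I) * Complex.I).re =
      -(r * Real.sin θ) := by
    intro r θ
    rw [Complex.mul_I_re, Complex.im_ofReal_mul, Complex.exp_ofReal_mul_I_im]
  have hkey : ∀ r θ : ℝ, 0 ≤ r → s₀ ≤ |Real.sin θ| →
      ‖g ((r : ℂ) * Complex.exp (θ * Complex.I) * Complex.I)‖ ≤
        M * Real.exp (2 * a / (1 + a) * r + D * (1 + (r / T) ^ β)) := by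
    intro r θ hr hs
    have hlin : ∀ s : ℝ, s₀ ≤ s → (r - r * s + a * (r + r * s)) / 2 ≤ 2 * a / (1 + a) * r := by
      intro s hs
      have h3 : 2 * a / (1 + a) * r = (r - r * s₀ + a * (r + r * s₀)) / 2 := by
        rw [hs₀]; have : (1 + a) ≠ 0 := by linarith
        field_simp
        ring
      have : 0 ≤ r * (1 - a) * (s - s₀) := by
        have : 0 ≤ s - s₀ := by linarith
        have : 0 ≤ 1 - a := by linarith
        positivity
      rw [h3]
      linarith
    rcases le_total 0 (Real.sin θ) with h0 | h0
    · rw [abs_of_nonneg h0] at hs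
      refine (h1 _).trans ?_
      rw [hnorm r θ hr, hre]
      gcongr
      exact le_trans (le_of_eq (by ring)) (hlin _ hs)
    · rw [abs_of_nonpos h0] at hs
      refine (h2 _).trans ?_
      rw [hnorm r θ hr, hre]
      gcongr
      exact le_trans (le_of_eq (by ring)) (hlin _ hs)
  rcases le_total |θ| ψ with hc | hc
  · have := norm_le_of_sector (g := fun u => g (u * Complex.I)) (hg.comp (by fun_prop))
      (M := M) hT hD hβ0 hβ1 hsq0.le hM hψ0 hψ1 (fun u => ?_) (fun r θ hr hθ => ?_) hc
    · refine this.trans (mul_le_mul_of_nonneg_left (Real.exp_le_exp.mpr ?_) hM)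
      rw [mul_add, mul_one_div]
      linarith
    · refine (h1 _).trans ?_
      rw [norm_mul, Complex.norm_I, mul_one]
      gcongr
      have h3 := Complex.abs_re_le_norm (u * Complex.I)
      rw [norm_mul, Complex.norm_I, mul_one, abs_le] at h3
      nlinarith
    · refine (hkey r θ hr.le ?_).trans (le_of_eq ?_)
      · rcases abs_choice θ with h | h
        · rw [← hsin, ← hθ, h]; exact le_abs_self _
        · rw [← hsin, ← hθ, h, Real.sin_neg]; exact neg_le_abs _
      · rw [← Real.cos_abs θ, hθ, hcosψ]
        congr 3
        rw [show Real.sqrt a * (r * (2 * Real.sqrt a / (1 + a))) =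
          2 * (Real.sqrt a ^ 2) / (1 + a) * r by ring, hsq]
  · refine (hkey T θ hT.le ?_).trans ?_
    · have h3 : Real.sin ψ ≤ Real.sin |θ| :=
        Real.sin_le_sin_of_le_of_le_pi_div_two (by linarith) hθ hc
      rw [hsin] at h3
      refine h3.trans ?_
      rcases abs_choice θ with h | h
      · rw [h]; exact le_abs_self _
      · rw [h, Real.sin_neg]; exact neg_le_abs _
    · rw [div_self hT.ne', Real.one_rpow]
      have h3 : 2 * a / (1 + a) ≤ Real.sqrt a := by
        rw [div_le_iff₀ (by linarith)]
        nlinarith [sq_nonneg (Real.sqrt a - 1), mul_nonneg hsq0.le (sq_nonneg (Real.sqrt a - 1))]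
      have h4 : 1 ≤ 1 / Real.cos (β * (Real.pi / 2)) := by
        rw [one_le_div hγ0]; exact Real.cos_le_one _
      gcongr
      linarith

/-- An entire function of exponential type bounded by complementary exponentials in the two
half-planes has small growth on circles. -/
theorem norm_le_of_entire {g : ℂ → ℂ} (hg : Differentiable ℂ g) {M T D a β : ℝ} (hT : 0 < T)
    (hD : 0 ≤ D) (hβ0 : 0 < β) (hβ1 : β < 1) (ha0 : 0 < a) (ha1 : a < 1) (hM : 0 ≤ M)
    (h1 : ∀ t : ℂ, ‖g t‖ ≤ M * Real.exp (((‖t‖ + t.re) + a * (‖t‖ - t.re)) / 2 +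
      D * (1 + (‖t‖ / T) ^ β)))
    (h2 : ∀ t : ℂ, ‖g t‖ ≤ M * Real.exp (((‖t‖ - t.re) + a * (‖t‖ + t.re)) / 2 +
      D * (1 + (‖t‖ / T) ^ β)))
    {t : ℂ} (ht : ‖t‖ = T) :
    ‖g t‖ ≤ M * Real.exp (Real.sqrt a * T + D * (2 + 1 / Real.cos (β * (Real.pi / 2)))) := by
  have hrep : ∀ u : ℂ, ‖u‖ = T → u = T * Complex.exp (u.arg * Complex.I) := by
    intro u hu
    rw [← hu, Complex.norm_mul_exp_arg_mul_I]
  set u := t * (-Complex.I) with hu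
  have hun : ‖u‖ = T := by rw [hu, norm_mul, norm_neg, Complex.norm_I, mul_one, ht]
  have htu : t = u * Complex.I := by rw [hu, mul_assoc, neg_mul, Complex.I_mul_I, neg_neg, mul_one]
  rcases le_total 0 u.re with h | h
  · have := norm_le_of_half_plane hg hT hD hβ0 hβ1 ha0 ha1 hM h1 h2
      (Complex.abs_arg_le_pi_div_two_iff.mpr h)
    rwa [← hrep u hun, ← htu] at this
  -- Replacing t by -t exchanges the two hypotheses and reduces the lower half-plane to the upper
  -- one.
  · have hneg : 0 ≤ (-u).re := by rw [Complex.neg_re]; linarith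
    have := norm_le_of_half_plane (g := fun t => g (-t)) (hg.comp (by fun_prop)) hT hD hβ0 hβ1 ha0
      ha1 hM (fun t => by simpa [sub_eq_add_neg] using h2 (-t))
      (fun t => by simpa [sub_eq_add_neg] using h1 (-t))
      (Complex.abs_arg_le_pi_div_two_iff.mpr hneg)
    rw [← hrep (-u) (by rw [norm_neg, hun])] at this
    rwa [neg_mul, neg_neg, ← htu] at this

/-! ### The Bessel–Clifford function and Poisson's integral -/

theorem Gamma_nat_add_pos {ν : ℝ} (hν : -1 / 2 < ν) (n : ℕ) : 0 < Real.Gamma (n + ν + 1) :=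
  Real.Gamma_pos_of_pos (by have : (0 : ℝ) ≤ n := n.cast_nonneg
                            linarith)

theorem summable_pow_div_Gamma {ν : ℝ} (hν : -1 / 2 < ν) (y : ℝ) :
    Summable (fun n : ℕ => y ^ n / Real.Gamma (n + ν + 1)) := by
  rcases eq_or_ne y 0 with rfl | hy
  · refine summable_of_ne_finset_zero (s := {0}) fun n hn => ?_
    simp only [Finset.mem_singleton] at hn
    simp [hn]
  refine summable_of_ratio_test_tendsto_lt_one (l := 0) (by norm_num)
    (Eventually.of_forall fun n => div_ne_zero (pow_ne_zero _ hy) (Gamma_nat_add_pos hν n).ne') ?_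
  have h : Tendsto (fun n : ℕ => |y| / ((n : ℝ) + (ν + 1))) atTop (nhds 0) :=
    tendsto_const_nhds.div_atTop (tendsto_atTop_add_const_right _ _ tendsto_natCast_atTop_atTop)
  refine h.congr fun n => ?_
  have hG := Gamma_nat_add_pos hν n
  have hn : (0 : ℝ) < n + ν + 1 := by have : (0 : ℝ) ≤ n := n.cast_nonneg
                                      linarith
  rw [← norm_div, show ((n + 1 : ℕ) : ℝ) + ν + 1 = (n + ν + 1) + 1 by push_cast; ring,
    Real.Gamma_add_one hn.ne', pow_succ, Real.norm_eq_abs,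
    show y ^ n * y / ((n + ν + 1) * Real.Gamma (n + ν + 1)) / (y ^ n / Real.Gamma (n + ν + 1)) =
      y / (n + ν + 1) by
        have := pow_ne_zero n hy
        field_simp, abs_div, abs_of_pos hn, add_assoc]

/-- Taylor coefficients of the Bessel–Clifford function. -/
noncomputable def cliffCoeff (ν : ℝ) (n : ℕ) : ℝ := 1 / (n.factorial * Real.Gamma (n + ν + 1))

theorem cliffCoeff_pos {ν : ℝ} (hν : -1 / 2 < ν) (n : ℕ) : 0 < cliffCoeff ν n := by
  have := Gamma_nat_add_pos hν n
  have : (0 : ℝ) < n.factorial := by exact_mod_cast n.factorial_pos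
  unfold cliffCoeff
  positivity

theorem summable_cliff_real {ν : ℝ} (hν : -1 / 2 < ν) {y : ℝ} (hy : 0 ≤ y) :
    Summable (fun n : ℕ => y ^ n * cliffCoeff ν n) := by
  refine (summable_pow_div_Gamma hν y).of_nonneg_of_le
    (fun n => mul_nonneg (pow_nonneg hy n) (cliffCoeff_pos hν n).le) fun n => ?_
  have hG := Gamma_nat_add_pos hν n
  have h1 : (1 : ℝ) ≤ n.factorial := by exact_mod_cast n.factorial_pos
  rw [cliffCoeff, mul_one_div]
  gcongr
  exact le_mul_of_one_le_left hG.le h1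

/-- The Bessel–Clifford function `∑ uⁿ / (n! Γ(n+ν+1))`. -/
noncomputable def cliff (ν : ℝ) (u : ℂ) : ℂ := ∑' n : ℕ, u ^ n * (cliffCoeff ν n : ℂ)

theorem summable_norm_cliff {ν : ℝ} (hν : -1 / 2 < ν) (u : ℂ) :
    Summable (fun n : ℕ => ‖u ^ n * (cliffCoeff ν n : ℂ)‖) := by
  refine (summable_cliff_real hν (norm_nonneg u)).congr fun n => ?_
  rw [norm_mul, norm_pow, Complex.norm_of_nonneg (cliffCoeff_pos hν n).le]

theorem hasSum_cliff {ν : ℝ} (hν : -1 / 2 < ν) (u : ℂ) :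
    HasSum (fun n : ℕ => u ^ n * (cliffCoeff ν n : ℂ)) (cliff ν u) :=
  (summable_norm_cliff hν u).of_norm.hasSum

theorem continuous_cliff {ν : ℝ} (hν : -1 / 2 < ν) : Continuous (cliff ν) := by
  rw [← continuousOn_univ]
  have : ∀ R : ℝ, ContinuousOn (cliff ν) (Metric.ball 0 R) := by
    intro R
    refine continuousOn_tsum (u := fun n => (max R 0) ^ n * cliffCoeff ν n)
      (fun n => by fun_prop) (summable_cliff_real hν (le_max_right _ _)) fun n x hx => ?_
    rw [norm_mul, norm_pow, Complex.norm_of_nonneg (cliffCoeff_pos hν n).le]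
    have := (cliffCoeff_pos hν n).le
    have : ‖x‖ ≤ max R 0 := (mem_ball_zero_iff.mp hx).le.trans (le_max_left _ _)
    gcongr
  intro x _
  exact ((this (‖x‖ + 1)).continuousAt
    (Metric.isOpen_ball.mem_nhds (by simp))).continuousWithinAt

theorem norm_cliff_le {ν : ℝ} (hν : -1 / 2 < ν) (u : ℂ) : ‖cliff ν u‖ ≤ (cliff ν ‖u‖).re := by
  have h := (Complex.hasSum_re (hasSum_cliff hν ‖u‖))
  refine tsum_of_norm_bounded h fun n => le_of_eq ?_
  rw [← Complex.ofReal_pow, ← Complex.ofReal_mul, Complex.ofReal_re, norm_mul, norm_pow,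
    Complex.norm_of_nonneg (cliffCoeff_pos hν n).le]

theorem integral_beta {a b : ℝ} (ha : 0 < a) (hb : 0 < b) :
    IntegrableOn (fun x : ℝ => x ^ (a - 1) * (1 - x) ^ (b - 1)) (Ioo 0 1) ∧
    ∫ x in Ioo (0 : ℝ) 1, x ^ (a - 1) * (1 - x) ^ (b - 1) =
      Real.Gamma a * Real.Gamma b / Real.Gamma (a + b) := by
  have hcongr : ∀ x ∈ Ioo (0 : ℝ) 1, (x : ℂ) ^ ((a : ℂ) - 1) * (1 - (x : ℂ)) ^ ((b : ℂ) - 1) =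
      ((x ^ (a - 1) * (1 - x) ^ (b - 1) : ℝ) : ℂ) := by
    intro x hx
    rw [Complex.ofReal_mul, Complex.ofReal_cpow hx.1.le, Complex.ofReal_cpow (by linarith [hx.2])]
    push_cast
    rfl
  have hI := Complex.betaIntegral_convergent (u := a) (v := b) (by simpa) (by simpa)
  rw [intervalIntegrable_iff_integrableOn_Ioo_of_le zero_le_one] at hI
  have hI' := hI.congr_fun hcongr measurableSet_Ioo
  have hI2 : IntegrableOn (fun x : ℝ => x ^ (a - 1) * (1 - x) ^ (b - 1)) (Ioo 0 1) := by
    have h := Integrable.re hI'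
    simpa [IntegrableOn] using h
  refine ⟨hI2, ?_⟩
  have h := Complex.Gamma_mul_Gamma_eq_betaIntegral (s := a) (t := b) (by simpa) (by simpa)
  rw [Complex.betaIntegral, intervalIntegral.integral_of_le zero_le_one,
    integral_Ioc_eq_integral_Ioo, setIntegral_congr_fun measurableSet_Ioo hcongr,
    integral_complex_ofReal, Complex.Gamma_ofReal, Complex.Gamma_ofReal, ← Complex.ofReal_add,
    Complex.Gamma_ofReal] at h
  have h' : Real.Gamma a * Real.Gamma b = Real.Gamma (a + b) *
      ∫ x in Ioo (0 : ℝ) 1, x ^ (a - 1) * (1 - x) ^ (b - 1) := by exact_mod_cast h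
  rw [h', mul_div_cancel_left₀ _ (Real.Gamma_pos_of_pos (by linarith)).ne']

/-- The substitution x = s² in the beta integral with parameters n + 1/2 and ν + 1/2. -/
theorem integral_even_moment {ν : ℝ} (hν : -1 / 2 < ν) (n : ℕ) :
    IntegrableOn (fun s : ℝ => s ^ (2 * n) * (1 - s ^ 2) ^ (ν - 1 / 2)) (Ioo 0 1) ∧
    ∫ s in Ioo (0 : ℝ) 1, 2 * (s ^ (2 * n) * (1 - s ^ 2) ^ (ν - 1 / 2)) =
      Real.Gamma (n + 1 / 2) * Real.Gamma (ν + 1 / 2) / Real.Gamma (n + ν + 1) := by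
  have hn : (0 : ℝ) ≤ n := n.cast_nonneg
  obtain ⟨h1, h2⟩ := integral_beta (a := n + 1 / 2) (b := ν + 1 / 2) (by linarith) (by linarith)
  have himg : (fun x : ℝ => x ^ 2) '' Ioo 0 1 = Ioo 0 1 := by
    ext y
    constructor
    · rintro ⟨x, hx, rfl⟩
      exact ⟨pow_pos hx.1 2, pow_lt_one₀ hx.1.le hx.2 two_ne_zero⟩
    · intro hy
      refine ⟨Real.sqrt y, ⟨Real.sqrt_pos.mpr hy.1, ?_⟩, Real.sq_sqrt hy.1.le⟩
      rw [Real.sqrt_lt' one_pos]; simpa using hy.2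
  have hd : ∀ x ∈ Ioo (0 : ℝ) 1, HasDerivWithinAt (fun x : ℝ => x ^ 2) (2 * x) (Ioo 0 1) x := by
    intro x _
    simpa using (hasDerivAt_pow 2 x).hasDerivWithinAt
  have hinj : InjOn (fun x : ℝ => x ^ 2) (Ioo 0 1) := by
    intro x hx y hy h
    exact (pow_left_inj₀ hx.1.le hy.1.le two_ne_zero).mp h
  have hcongr : ∀ x ∈ Ioo (0 : ℝ) 1, |2 * x| • ((x ^ 2) ^ ((n : ℝ) + 1 / 2 - 1) *
      (1 - x ^ 2) ^ (ν + 1 / 2 - 1)) = 2 * (x ^ (2 * n) * (1 - x ^ 2) ^ (ν - 1 / 2)) := by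
    intro x hx
    have hx0 := hx.1
    rw [abs_of_pos (by linarith), smul_eq_mul, ← Real.rpow_natCast x 2, ← Real.rpow_mul hx0.le,
      show ((2 : ℕ) : ℝ) * ((n : ℝ) + 1 / 2 - 1) = ((2 * n : ℕ) : ℝ) - 1 by push_cast; ring,
      Real.rpow_sub hx0, Real.rpow_natCast, Real.rpow_one,
      show ν + 1 / 2 - 1 = ν - 1 / 2 by ring]
    field_simp
  have h3 := (integrableOn_image_iff_integrableOn_abs_deriv_smul measurableSet_Ioo hd hinj
    (fun x : ℝ => x ^ ((n : ℝ) + 1 / 2 - 1) * (1 - x) ^ (ν + 1 / 2 - 1)))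
  have h4 := (integral_image_eq_integral_abs_deriv_smul measurableSet_Ioo hd hinj
    (fun x : ℝ => x ^ ((n : ℝ) + 1 / 2 - 1) * (1 - x) ^ (ν + 1 / 2 - 1)))
  rw [himg] at h3 h4
  rw [setIntegral_congr_fun measurableSet_Ioo hcongr, h2] at h4
  have h5 := (h3.mp h1).congr_fun hcongr measurableSet_Ioo
  refine ⟨?_, ?_⟩
  · have h6 : IntegrableOn _ (Ioo (0 : ℝ) 1) := h5.const_mul (1 / 2)
    refine h6.congr_fun (fun x _ => ?_) measurableSet_Ioo
    ring
  · rw [← h4]; congr 2; ring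

/-- A case of the duplication formula; it matches the factorials of the cosh series with the
coefficients `cliffCoeff`. -/
theorem factorial_two_mul_mul_sqrt_pi (n : ℕ) :
    ((2 * n).factorial : ℝ) * Real.sqrt Real.pi = 4 ^ n * n.factorial * Real.Gamma (n + 1 / 2) := by
  induction n with
  | zero => rw [Nat.cast_zero, zero_add, Real.Gamma_one_half_eq]; simp
  | succ n ih =>
    have hn : (0 : ℝ) < (n : ℝ) + 1 / 2 := by positivity
    rw [show 2 * (n + 1) = (2 * n + 1) + 1 by ring, Nat.factorial_succ, Nat.factorial_succ,
      Nat.factorial_succ, show ((n + 1 : ℕ) : ℝ) + 1 / 2 = (n + 1 / 2) + 1 by push_cast; ring,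
      Real.Gamma_add_one hn.ne']
    push_cast
    linear_combination (2 * (n : ℝ) + 1 + 1) * (2 * n + 1) * ih

theorem intervalIntegrable_jacobiWeight {ν : ℝ} (hν : -1 / 2 < ν) :
    IntervalIntegrable (fun s : ℝ => (1 - s ^ 2) ^ (ν - 1 / 2)) volume (-1) 1 := by
  have h0 : IntervalIntegrable (fun s : ℝ => (1 - s ^ 2) ^ (ν - 1 / 2)) volume 0 1 := by
    rw [intervalIntegrable_iff_integrableOn_Ioo_of_le zero_le_one]
    simpa using (integral_even_moment hν 0).1
  have h2 := (IntervalIntegrable.iff_comp_neg (by simp)).mp h0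
  simp only [neg_sq, neg_zero] at h2
  exact h2.symm.trans h0

theorem intervalIntegrable_exp_mul_jacobiWeight {ν : ℝ} (hν : -1 / 2 < ν) (z : ℂ) :
    IntervalIntegrable (fun s : ℝ => Complex.exp (z * s) * (((1 - s ^ 2) ^ (ν - 1 / 2) : ℝ) : ℂ))
      volume (-1) 1 := by
  have h : IntervalIntegrable (fun s : ℝ => (((1 - s ^ 2) ^ (ν - 1 / 2) : ℝ) : ℂ)) volume (-1) 1 :=
    ⟨(intervalIntegrable_jacobiWeight hν).1.ofReal, (intervalIntegrable_jacobiWeight hν).2.ofReal⟩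
  exact h.continuousOn_mul (by fun_prop)

/-- Poisson's integral representation. -/
theorem integral_exp_mul_jacobiWeight {ν : ℝ} (hν : -1 / 2 < ν) (z : ℂ) :
    ∫ s in (-1 : ℝ)..1, Complex.exp (z * s) * (((1 - s ^ 2) ^ (ν - 1 / 2) : ℝ) : ℂ) =
      ((Real.Gamma (ν + 1 / 2) * Real.Gamma (1 / 2) : ℝ) : ℂ) * cliff ν (z ^ 2 / 4) := by
  set ω : ℝ → ℂ := fun s => (((1 - s ^ 2) ^ (ν - 1 / 2) : ℝ) : ℂ) with hω
  have hint := intervalIntegrable_exp_mul_jacobiWeight hν z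
  have hsub1 : uIcc (-1 : ℝ) 0 ⊆ uIcc (-1) 1 := by
    rw [uIcc_of_le (by norm_num), uIcc_of_le (by norm_num)]; exact Icc_subset_Icc le_rfl (by norm_num)
  have hsub2 : uIcc (0 : ℝ) 1 ⊆ uIcc (-1) 1 := by
    rw [uIcc_of_le (by norm_num), uIcc_of_le (by norm_num)]; exact Icc_subset_Icc (by norm_num) le_rfl
  have hrefl : ∫ s in (-1 : ℝ)..0, Complex.exp (z * s) * ω s =
      ∫ s in (0 : ℝ)..1, Complex.exp (-(z * s)) * ω s := by
    have := intervalIntegral.integral_comp_neg (a := (0 : ℝ)) (b := 1)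
      (fun s : ℝ => Complex.exp (z * s) * ω s)
    rw [neg_zero] at this
    rw [← this]
    simp [hω]
  have hint' : IntervalIntegrable (fun s : ℝ => Complex.exp (-(z * s)) * ω s) volume 0 1 := by
    have := (intervalIntegrable_exp_mul_jacobiWeight hν (-z)).mono_set hsub2
    simpa [hω, neg_mul] using this
  rw [← intervalIntegral.integral_add_adjacent_intervals (hint.mono_set hsub1)
    (hint.mono_set hsub2), hrefl, ← intervalIntegral.integral_add hint' (hint.mono_set hsub2),
    intervalIntegral.integral_of_le zero_le_one, integral_Ioc_eq_integral_Ioo]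
  set c : ℝ := Real.Gamma (ν + 1 / 2) * Real.Gamma (1 / 2) with hc
  have hc0 : 0 ≤ c := by
    have h1 : 0 < Real.Gamma (ν + 1 / 2) := Real.Gamma_pos_of_pos (by linarith)
    have h2 : 0 < Real.Gamma (1 / 2) := Real.Gamma_pos_of_pos (by norm_num)
    positivity
  have hmom : ∀ n : ℕ, ∫ s in Ioo (0 : ℝ) 1, 2 * (s ^ (2 * n) * (1 - s ^ 2) ^ (ν - 1 / 2)) =
      c * (2 * n).factorial / 4 ^ n * cliffCoeff ν n := by
    intro n
    have h1 := factorial_two_mul_mul_sqrt_pi n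
    rw [(integral_even_moment hν n).2, hc, cliffCoeff, Real.Gamma_one_half_eq]
    have := Gamma_nat_add_pos hν n
    have h3 : (n.factorial : ℝ) ≠ 0 := by exact_mod_cast n.factorial_ne_zero
    generalize Real.Gamma (ν + 1 / 2) = G at *
    generalize Real.Gamma (n + 1 / 2) = G' at *
    field_simp
    linear_combination (-G) * h1
  -- After folding [-1, 1] onto [0, 1] the exponential has become 2 cosh(zs); these are the terms of
  -- its series times the weight.
  set F : ℕ → ℝ → ℂ := fun n s => (z ^ (2 * n) / ((2 * n).factorial : ℂ)) *
    ((2 * (s ^ (2 * n) * (1 - s ^ 2) ^ (ν - 1 / 2)) : ℝ) : ℂ) with hF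
  have hFint : ∀ n, Integrable (F n) (volume.restrict (Ioo (0 : ℝ) 1)) := fun n =>
    (((integral_even_moment hν n).1.const_mul 2).ofReal).const_mul _
  have hFn : ∀ n, ∫ s in Ioo (0 : ℝ) 1, F n s = c * ((z ^ 2 / 4) ^ n * cliffCoeff ν n) := by
    intro n
    rw [hF, integral_const_mul, integral_complex_ofReal, hmom]
    have h3 : ((2 * n).factorial : ℂ) ≠ 0 := by exact_mod_cast (2 * n).factorial_ne_zero
    push_cast
    rw [div_pow, ← pow_mul]
    field_simp
  have hFnn : ∀ n, ∫ s in Ioo (0 : ℝ) 1, ‖F n s‖ = c * ((‖z‖ ^ 2 / 4) ^ n * cliffCoeff ν n) := by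
    intro n
    have : ∀ s ∈ Ioo (0 : ℝ) 1, ‖F n s‖ = (‖z‖ ^ (2 * n) / (2 * n).factorial) *
        (2 * (s ^ (2 * n) * (1 - s ^ 2) ^ (ν - 1 / 2))) := by
      intro s hs
      have h1 : 0 ≤ 1 - s ^ 2 := by nlinarith [hs.1, hs.2]
      have h2 := hs.1.le
      rw [hF, norm_mul, Complex.norm_of_nonneg (by positivity)]
      simp
    rw [setIntegral_congr_fun measurableSet_Ioo this, integral_const_mul, hmom]
    have h3 : ((2 * n).factorial : ℝ) ≠ 0 := by exact_mod_cast (2 * n).factorial_ne_zero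
    rw [div_pow, ← pow_mul]
    field_simp
  have hS := hasSum_integral_of_summable_integral_norm hFint (by
    simp only [hFnn]
    exact (summable_cliff_real hν (by positivity)).mul_left c)
  simp only [hFn] at hS
  rw [← HasSum.unique hS ((hasSum_cliff hν (z ^ 2 / 4)).mul_left _)]
  congr 1
  ext s
  have h1 := ((Complex.hasSum_cosh (z * s)).mul_right (2 * ω s))
  have h2 : (fun n : ℕ => (z * s) ^ (2 * n) / ((2 * n).factorial : ℂ) * (2 * ω s)) =
      fun n => F n s := by
    ext n
    simp only [hF, hω]
    push_cast
    ring
  rw [h2] at h1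
  rw [h1.tsum_eq, Complex.cosh]
  ring

/-- The weight in Poisson's integral is nonnegative, so replacing e^{zs} by its modulus replaces z
by Re z. The majorant is again a Bessel–Clifford function, whose Gaussian integral is known exactly.
-/
theorem norm_cliff_sq_le_re {ν : ℝ} (hν : -1 / 2 < ν) (z : ℂ) :
    ‖cliff ν (z ^ 2 / 4)‖ ≤ (cliff ν ((z.re : ℂ) ^ 2 / 4)).re := by
  set c : ℝ := Real.Gamma (ν + 1 / 2) * Real.Gamma (1 / 2) with hc
  have hc0 : 0 < c := by
    have h1 : 0 < Real.Gamma (ν + 1 / 2) := Real.Gamma_pos_of_pos (by linarith)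
    have h2 : 0 < Real.Gamma (1 / 2) := Real.Gamma_pos_of_pos (by norm_num)
    positivity
  have h1 := integral_exp_mul_jacobiWeight hν z
  have h2 := integral_exp_mul_jacobiWeight hν (z.re : ℂ)
  have h3 : ‖∫ s in (-1 : ℝ)..1, Complex.exp (z * s) * (((1 - s ^ 2) ^ (ν - 1 / 2) : ℝ) : ℂ)‖ ≤
      ∫ s in (-1 : ℝ)..1, Real.exp (z.re * s) * (1 - s ^ 2) ^ (ν - 1 / 2) := by
    refine (intervalIntegral.norm_integral_le_integral_norm (by norm_num)).trans (le_of_eq ?_)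
    refine intervalIntegral.integral_congr fun s hs => ?_
    rw [uIcc_of_le (by norm_num)] at hs
    have h4 : 0 ≤ 1 - s ^ 2 := by nlinarith [hs.1, hs.2]
    simp only [norm_mul, Complex.norm_exp]
    rw [Complex.norm_of_nonneg (by positivity)]
    simp
  have h5 : ∫ s in (-1 : ℝ)..1, Complex.exp ((z.re : ℂ) * s) *
      (((1 - s ^ 2) ^ (ν - 1 / 2) : ℝ) : ℂ) =
      ((∫ s in (-1 : ℝ)..1, Real.exp (z.re * s) * (1 - s ^ 2) ^ (ν - 1 / 2) : ℝ) : ℂ) := by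
    rw [← intervalIntegral.integral_ofReal]
    congr 1
    ext s
    push_cast
    rfl
  rw [h5] at h2
  have h6 := congrArg Complex.re h2
  rw [Complex.ofReal_re, Complex.re_ofReal_mul] at h6
  rw [h6, h1, norm_mul, Complex.norm_of_nonneg hc0.le] at h3
  exact le_of_mul_le_mul_left h3 hc0

theorem cliff_zero (ν : ℝ) : cliff ν 0 = ((1 / Real.Gamma (ν + 1) : ℝ) : ℂ) := by
  rw [cliff, tsum_eq_single 0 (by intro n hn; simp [hn])]
  simp [cliffCoeff]

/-- Here e^{zs} is bounded by its maximum on [-1, 1], and z = 0 in Poisson's integral evaluates the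
mass of the weight. -/
theorem norm_cliff_sq_le_exp {ν : ℝ} (hν : -1 / 2 < ν) (z : ℂ) :
    ‖cliff ν (z ^ 2 / 4)‖ ≤ 1 / Real.Gamma (ν + 1) * Real.exp |z.re| := by
  set c : ℝ := Real.Gamma (ν + 1 / 2) * Real.Gamma (1 / 2) with hc
  have hc0 : 0 < c := by
    have h1 : 0 < Real.Gamma (ν + 1 / 2) := Real.Gamma_pos_of_pos (by linarith)
    have h2 : 0 < Real.Gamma (1 / 2) := Real.Gamma_pos_of_pos (by norm_num)
    positivity
  have h1 := integral_exp_mul_jacobiWeight hν z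
  have h2 := integral_exp_mul_jacobiWeight hν 0
  have h5 : ∫ s in (-1 : ℝ)..1, Complex.exp (0 * s) *
      (((1 - s ^ 2) ^ (ν - 1 / 2) : ℝ) : ℂ) =
      ((∫ s in (-1 : ℝ)..1, (1 - s ^ 2) ^ (ν - 1 / 2) : ℝ) : ℂ) := by
    rw [← intervalIntegral.integral_ofReal]
    simp
  rw [h5, show (0 : ℂ) ^ 2 / 4 = 0 by simp, cliff_zero, ← Complex.ofReal_mul,
    Complex.ofReal_inj] at h2
  have h3 : ‖∫ s in (-1 : ℝ)..1, Complex.exp (z * s) * (((1 - s ^ 2) ^ (ν - 1 / 2) : ℝ) : ℂ)‖ ≤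
      ∫ s in (-1 : ℝ)..1, Real.exp |z.re| * (1 - s ^ 2) ^ (ν - 1 / 2) := by
    refine intervalIntegral.norm_integral_le_of_norm_le (by norm_num)
      (Eventually.of_forall fun s hs => ?_) ((intervalIntegrable_jacobiWeight hν).const_mul _)
    have h4 : 0 ≤ 1 - s ^ 2 := by nlinarith [hs.1, hs.2]
    rw [norm_mul, Complex.norm_exp, Complex.norm_of_nonneg (by positivity)]
    gcongr
    simp only [Complex.mul_re, Complex.ofReal_re, Complex.ofReal_im, mul_zero, sub_zero]
    calc z.re * s ≤ |z.re * s| := le_abs_self _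
      _ = |z.re| * |s| := abs_mul _ _
      _ ≤ |z.re| * 1 := by gcongr; exact abs_le.mpr ⟨hs.1.le, hs.2⟩
      _ = |z.re| := mul_one _
  rw [intervalIntegral.integral_const_mul, h2, h1, norm_mul, Complex.norm_of_nonneg hc0.le] at h3
  refine le_of_mul_le_mul_left (h3.trans (le_of_eq (by ring))) hc0

/-- The Bessel kernel of the Hankel transform. -/
theorem besselJ_div_rpow {ν : ℝ} (hν : -1 / 2 < ν) {x : ℝ} (hx : 0 < x) :
    besselJ ν (x : ℂ) / ((x ^ ν : ℝ) : ℂ) = ((2 ^ (-ν) : ℝ) : ℂ) * cliff ν (-(x : ℂ) ^ 2 / 4) := by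
  have hc0 : (0 : ℝ) < Real.Gamma (ν + 1 / 2) * Real.Gamma (1 / 2) := by
    have h1 : 0 < Real.Gamma (ν + 1 / 2) := Real.Gamma_pos_of_pos (by linarith)
    have h2 : 0 < Real.Gamma (1 / 2) := Real.Gamma_pos_of_pos (by norm_num)
    positivity
  have hxν : (0 : ℝ) < x ^ ν := Real.rpow_pos_of_pos hx _
  have h1 := integral_exp_mul_jacobiWeight hν (Complex.I * x)
  rw [besselJ, h1, mul_pow, Complex.I_sq, neg_one_mul,
    show ((x : ℂ) / 2) ^ (ν : ℂ) = ((x ^ ν * 2 ^ (-ν) : ℝ) : ℂ) by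
      rw [show ((x : ℂ) / 2) = ((x / 2 : ℝ) : ℂ) by push_cast; rfl,
        ← Complex.ofReal_cpow (by positivity), Real.div_rpow hx.le (by norm_num),
        Real.rpow_neg (by norm_num), div_eq_mul_inv]]
  have h3 : ((x ^ ν : ℝ) : ℂ) ≠ 0 := by exact_mod_cast hxν.ne'
  have h4 : ((Real.Gamma (ν + 1 / 2) * Real.Gamma (1 / 2) : ℝ) : ℂ) ≠ 0 := by
    exact_mod_cast hc0.ne'
  rw [Complex.ofReal_mul (x ^ ν)]
  generalize ((Real.Gamma (ν + 1 / 2) * Real.Gamma (1 / 2) : ℝ) : ℂ) = G at *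
  field_simp

/-! ### Gaussian integrals for the measure r^{2ν+1} dr -/

instance instSFiniteMuNu (ν : ℝ) : SFinite (muNu ν) := by
  unfold muNu; infer_instance

theorem integral_muNu (ν : ℝ) (g : ℝ → ℂ) :
    ∫ r, g r ∂(muNu ν) = ∫ r in Ioi (0 : ℝ), g r * ((r ^ (2 * ν + 1) : ℝ) : ℂ) := by
  rw [muNu, integral_withDensity_eq_integral_toReal_smul (by fun_prop) (by simp)]
  refine setIntegral_congr_fun measurableSet_Ioi fun r hr => ?_
  have hr0 : (0 : ℝ) < r := hr
  simp only [ENNReal.toReal_ofReal (Real.rpow_nonneg hr0.le _), Complex.real_smul]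
  ring

theorem integral_muNu_real (ν : ℝ) (g : ℝ → ℝ) :
    ∫ r, g r ∂(muNu ν) = ∫ r in Ioi (0 : ℝ), g r * r ^ (2 * ν + 1) := by
  rw [muNu, integral_withDensity_eq_integral_toReal_smul (by fun_prop) (by simp)]
  refine setIntegral_congr_fun measurableSet_Ioi fun r hr => ?_
  have hr0 : (0 : ℝ) < r := hr
  simp only [ENNReal.toReal_ofReal (Real.rpow_nonneg hr0.le _), smul_eq_mul]
  ring

theorem integrable_muNu_iff (ν : ℝ) (g : ℝ → ℝ) :
    Integrable g (muNu ν) ↔ IntegrableOn (fun r => g r * r ^ (2 * ν + 1)) (Ioi 0) := by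
  rw [muNu, integrable_withDensity_iff_integrable_smul' (by fun_prop) (by simp)]
  refine integrableOn_congr_fun (fun r hr => ?_) measurableSet_Ioi
  have hr0 : (0 : ℝ) < r := hr
  simp only [ENNReal.toReal_ofReal (Real.rpow_nonneg hr0.le _), smul_eq_mul]
  ring

theorem ae_muNu {ν : ℝ} {P : ℝ → Prop} (h : ∀ᵐ r ∂(volume.restrict (Ioi (0 : ℝ))), P r) :
    ∀ᵐ r ∂(muNu ν), P r :=
  (withDensity_absolutelyContinuous _ _).ae_le h

theorem ae_muNu_pos (ν : ℝ) : ∀ᵐ r ∂(muNu ν), 0 < r :=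
  ae_muNu (ae_restrict_mem measurableSet_Ioi)

/-- The moment produces exactly the Γ(n+ν+1) in the denominator of `cliffCoeff`, so integrating the
Bessel–Clifford series termwise leaves an exponential series. -/
theorem gaussian_moment {ν : ℝ} (hν : -1 / 2 < ν) {c : ℝ} (hc : 0 < c) (n : ℕ) :
    Integrable (fun s : ℝ => (s ^ 2 / 2) ^ n * Real.exp (-(c * (s ^ 2 / 2)))) (muNu ν) ∧
    ∫ s, (s ^ 2 / 2) ^ n * Real.exp (-(c * (s ^ 2 / 2))) ∂(muNu ν) =
      2 ^ ν * Real.Gamma (n + ν + 1) * (c ^ (-(ν + 1)) / c ^ n) := by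
  have hn : (0 : ℝ) ≤ n := n.cast_nonneg
  have hcongr : ∀ s ∈ Ioi (0 : ℝ), (s ^ 2 / 2) ^ n * Real.exp (-(c * (s ^ 2 / 2))) *
      s ^ (2 * ν + 1) = (1 / 2 ^ n) * (s ^ ((2 * n : ℕ) + (2 * ν + 1)) *
        Real.exp (-(c / 2) * s ^ (2 : ℝ))) := by
    intro s hs
    have hs0 : (0 : ℝ) < s := hs
    rw [Real.rpow_add hs0 ((2 * n : ℕ) : ℝ), Real.rpow_natCast, Real.rpow_two, div_pow, ← pow_mul,
      show -(c / 2) * s ^ 2 = -(c * (s ^ 2 / 2)) by ring]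
    ring
  have hq : (-1 : ℝ) < (2 * n : ℕ) + (2 * ν + 1) := by push_cast; linarith
  constructor
  · rw [integrable_muNu_iff, integrableOn_congr_fun hcongr measurableSet_Ioi]
    exact (integrableOn_rpow_mul_exp_neg_mul_rpow hq (by norm_num) (by positivity)).const_mul _
  · rw [integral_muNu_real, setIntegral_congr_fun measurableSet_Ioi hcongr, integral_const_mul,
      integral_rpow_mul_exp_neg_mul_rpow (by norm_num) hq (by positivity)]
    have e1 : -(((2 * n : ℕ) : ℝ) + (2 * ν + 1) + 1) / 2 = -(ν + 1) - n := by push_cast; ring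
    have e2 : (((2 * n : ℕ) : ℝ) + (2 * ν + 1) + 1) / 2 = n + ν + 1 := by push_cast; ring
    rw [e1, e2, Real.rpow_sub (by positivity), Real.rpow_natCast, Real.div_rpow hc.le (by norm_num),
      Real.rpow_neg (by norm_num : (0 : ℝ) ≤ 2), Real.rpow_add (by norm_num), Real.rpow_one, div_pow]
    have : (0 : ℝ) < 2 ^ ν := by positivity
    field_simp

theorem integrable_gaussian {ν : ℝ} (hν : -1 / 2 < ν) {c : ℝ} (hc : 0 < c) :
    Integrable (fun s : ℝ => Real.exp (-(c * (s ^ 2 / 2)))) (muNu ν) := by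
  simpa using (gaussian_moment hν hc 0).1

theorem cliff_gaussian_series {ν : ℝ} (hν : -1 / 2 < ν) {c : ℝ} (hc : 0 < c) (y : ℂ) :
    (∀ n : ℕ, Integrable (fun s : ℝ => (y ^ n * cliffCoeff ν n) *
      (((s ^ 2 / 2) ^ n * Real.exp (-(c * (s ^ 2 / 2))) : ℝ) : ℂ)) (muNu ν)) ∧
    (∀ n : ℕ, ∫ s : ℝ, (y ^ n * cliffCoeff ν n) *
      (((s ^ 2 / 2) ^ n * Real.exp (-(c * (s ^ 2 / 2))) : ℝ) : ℂ) ∂(muNu ν) =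
      ((2 ^ ν * c ^ (-(ν + 1)) : ℝ) : ℂ) * ((y / c) ^ n / n.factorial)) ∧
    (∀ n : ℕ, ∫ s : ℝ, ‖(y ^ n * cliffCoeff ν n) *
      (((s ^ 2 / 2) ^ n * Real.exp (-(c * (s ^ 2 / 2))) : ℝ) : ℂ)‖ ∂(muNu ν) =
      (2 ^ ν * c ^ (-(ν + 1))) * ((‖y‖ / c) ^ n / n.factorial)) := by
  refine ⟨fun n => ((gaussian_moment hν hc n).1.ofReal).const_mul _, fun n => ?_, fun n => ?_⟩
  · rw [integral_const_mul, integral_complex_ofReal, (gaussian_moment hν hc n).2, cliffCoeff]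
    have := (Gamma_nat_add_pos hν n).ne'
    have h1 : ((Real.Gamma (n + ν + 1) : ℝ) : ℂ) ≠ 0 := by exact_mod_cast this
    have h2 : (n.factorial : ℂ) ≠ 0 := by exact_mod_cast n.factorial_ne_zero
    have h3 : (c : ℂ) ≠ 0 := by exact_mod_cast hc.ne'
    push_cast
    generalize ((Real.Gamma (n + ν + 1) : ℝ) : ℂ) = G at *
    rw [div_pow]
    field_simp
  · have : ∀ s : ℝ, ‖(y ^ n * cliffCoeff ν n) *
      (((s ^ 2 / 2) ^ n * Real.exp (-(c * (s ^ 2 / 2))) : ℝ) : ℂ)‖ =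
      (‖y‖ ^ n * cliffCoeff ν n) * ((s ^ 2 / 2) ^ n * Real.exp (-(c * (s ^ 2 / 2)))) := by
      intro s
      rw [norm_mul, norm_mul, norm_pow, Complex.norm_of_nonneg (cliffCoeff_pos hν n).le,
        Complex.norm_of_nonneg (by positivity)]
    simp only [this]
    rw [integral_const_mul, (gaussian_moment hν hc n).2, cliffCoeff]
    have h1 := (Gamma_nat_add_pos hν n).ne'
    have h2 : (n.factorial : ℝ) ≠ 0 := by exact_mod_cast n.factorial_ne_zero
    generalize Real.Gamma (n + ν + 1) = G at *
    rw [div_pow]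
    field_simp

/-- Weber's first exponential integral. -/
theorem integral_cliff_gaussian {ν : ℝ} (hν : -1 / 2 < ν) {c : ℝ} (hc : 0 < c) (y : ℂ) :
    ∫ s : ℝ, cliff ν (y * ((s ^ 2 / 2 : ℝ) : ℂ)) * ((Real.exp (-(c * (s ^ 2 / 2))) : ℝ) : ℂ)
      ∂(muNu ν) = ((2 ^ ν * c ^ (-(ν + 1)) : ℝ) : ℂ) * Complex.exp (y / c) := by
  obtain ⟨h1, h2, h3⟩ := cliff_gaussian_series hν hc y
  have hS := hasSum_integral_of_summable_integral_norm h1 (by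
    simp only [h3]; exact (Real.summable_pow_div_factorial _).mul_left _)
  simp only [h2] at hS
  have hE := (NormedSpace.expSeries_div_hasSum_exp (y / c)).mul_left
    ((2 ^ ν * c ^ (-(ν + 1)) : ℝ) : ℂ)
  rw [← Complex.exp_eq_exp_ℂ] at hE
  rw [← hS.unique hE]
  congr 1
  ext s
  have h4 := (hasSum_cliff hν (y * ((s ^ 2 / 2 : ℝ) : ℂ))).mul_right
    ((Real.exp (-(c * (s ^ 2 / 2))) : ℝ) : ℂ)
  rw [← h4.tsum_eq]
  congr 1
  ext n
  push_cast
  ring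

theorem integrable_cliff_gaussian {ν : ℝ} (hν : -1 / 2 < ν) {c : ℝ} (hc : 0 < c) (y : ℂ) :
    Integrable (fun s : ℝ => cliff ν (y * ((s ^ 2 / 2 : ℝ) : ℂ)) *
      ((Real.exp (-(c * (s ^ 2 / 2))) : ℝ) : ℂ)) (muNu ν) := by
  have hm : AEStronglyMeasurable (fun s : ℝ => cliff ν (y * ((s ^ 2 / 2 : ℝ) : ℂ)) *
      ((Real.exp (-(c * (s ^ 2 / 2))) : ℝ) : ℂ)) (muNu ν) := by
    have := continuous_cliff hν
    exact Continuous.aestronglyMeasurable (by fun_prop)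
  have hpos : ∀ s : ℝ, ‖cliff ν ((‖y‖ : ℂ) * ((s ^ 2 / 2 : ℝ) : ℂ)) *
      ((Real.exp (-(c * (s ^ 2 / 2))) : ℝ) : ℂ)‖ ≥ ‖cliff ν (y * ((s ^ 2 / 2 : ℝ) : ℂ)) *
      ((Real.exp (-(c * (s ^ 2 / 2))) : ℝ) : ℂ)‖ := by
    intro s
    rw [norm_mul, norm_mul]
    gcongr
    refine (norm_cliff_le hν _).trans ((Complex.re_le_norm _).trans (le_of_eq ?_))
    rw [norm_mul, Complex.norm_of_nonneg (by positivity : 0 ≤ s ^ 2 / 2), Complex.ofReal_mul]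
  have hI : Integrable (fun s : ℝ => cliff ν ((‖y‖ : ℂ) * ((s ^ 2 / 2 : ℝ) : ℂ)) *
      ((Real.exp (-(c * (s ^ 2 / 2))) : ℝ) : ℂ)) (muNu ν) := by
    -- The integral of a non-integrable function is 0 by convention, whereas the evaluated integral
    -- is nonzero.
    by_contra hn
    have h1 := integral_cliff_gaussian hν hc (‖y‖ : ℂ)
    rw [integral_undef hn] at h1
    have h2 : (2 ^ ν * c ^ (-(ν + 1)) : ℝ) ≠ 0 := by positivity
    exact mul_ne_zero (by exact_mod_cast h2) (Complex.exp_ne_zero _) h1.symm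
  exact hI.mono hm (Eventually.of_forall hpos)

/-! ### Generating functions of Laguerre polynomials -/

/-- The Laguerre polynomial divided by `Γ(k+ν+1)`. -/
noncomputable def laguerreNorm (ν : ℝ) (k : ℕ) (x : ℝ) : ℝ :=
  ∑ i ∈ Finset.range (k + 1), (-x) ^ i * cliffCoeff ν i * (1 / (k - i).factorial)

theorem laguerre_eq (ν : ℝ) (k : ℕ) (x : ℝ) :
    laguerre ν k x = Real.Gamma (k + ν + 1) * laguerreNorm ν k x := by
  rw [laguerre, laguerreNorm, Finset.mul_sum]
  refine Finset.sum_congr rfl fun i _ => ?_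
  rw [cliffCoeff, neg_pow, show (ν + i + 1 : ℝ) = i + ν + 1 by ring]
  simp only [div_eq_mul_inv, mul_inv, one_mul]
  ring

/-- The exponential generating function of the Laguerre polynomials. -/
theorem hasSum_laguerreNorm {ν : ℝ} (hν : -1 / 2 < ν) (x : ℝ) (t : ℂ) :
    HasSum (fun k => (laguerreNorm ν k x : ℂ) * t ^ k) (Complex.exp t * cliff ν (-x * t)) := by
  have hf := summable_norm_cliff hν (-x * t)
  have hg : Summable (fun n : ℕ => ‖t ^ n / (n.factorial : ℂ)‖) := by
    refine (Real.summable_pow_div_factorial ‖t‖).congr fun n => ?_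
    rw [norm_div, norm_pow, Complex.norm_natCast]
  have hE : ∑' n : ℕ, t ^ n / (n.factorial : ℂ) = Complex.exp t := by
    rw [Complex.exp_eq_exp_ℂ]
    exact (NormedSpace.expSeries_div_hasSum_exp t).tsum_eq
  have h := hasSum_sum_range_mul_of_summable_norm hf hg
  rw [hE, show (∑' n : ℕ, (-x * t) ^ n * (cliffCoeff ν n : ℂ)) = cliff ν (-x * t) from rfl,
    mul_comm (cliff ν _)] at h
  refine h.congr_fun ?_
  intro k
  rw [laguerreNorm]
  push_cast
  rw [Finset.sum_mul]
  refine Finset.sum_congr rfl fun i hi => ?_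
  have hik : i ≤ k := Nat.lt_succ_iff.mp (Finset.mem_range.mp hi)
  rw [mul_pow, show t ^ k = t ^ i * t ^ (k - i) by rw [← pow_add, Nat.add_sub_cancel' hik]]
  ring

theorem laguerreNorm_neg_nonneg {ν : ℝ} (hν : -1 / 2 < ν) (k : ℕ) {x : ℝ} (hx : 0 ≤ x) :
    0 ≤ laguerreNorm ν k (-x) := by
  refine Finset.sum_nonneg fun i _ => ?_
  have := (cliffCoeff_pos hν i).le
  rw [neg_neg]
  positivity

theorem abs_laguerreNorm_le {ν : ℝ} (hν : -1 / 2 < ν) (k : ℕ) {x : ℝ} (hx : 0 ≤ x) :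
    |laguerreNorm ν k x| ≤ laguerreNorm ν k (-x) := by
  refine (Finset.abs_sum_le_sum_abs _ _).trans (le_of_eq (Finset.sum_congr rfl fun i _ => ?_))
  have := (cliffCoeff_pos hν i).le
  rw [neg_neg, mul_assoc, mul_assoc, abs_mul, abs_pow, abs_neg, abs_of_nonneg hx,
    abs_of_nonneg (by positivity : (0 : ℝ) ≤ cliffCoeff ν i * (1 / (k - i).factorial))]

theorem laguerreNorm_neg_mul_pow_le {ν : ℝ} (hν : -1 / 2 < ν) (k : ℕ) {x τ : ℝ} (hx : 0 ≤ x)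
    (hτ : 0 ≤ τ) :
    laguerreNorm ν k (-x) * τ ^ k ≤ Real.exp τ * (cliff ν ((x * τ : ℝ) : ℂ)).re := by
  have h := Complex.hasSum_re (hasSum_laguerreNorm hν (-x) (τ : ℂ))
  have e : -((-x : ℝ) : ℂ) * (τ : ℂ) = ((x * τ : ℝ) : ℂ) := by push_cast; ring
  rw [e, ← Complex.ofReal_exp, Complex.re_ofReal_mul] at h
  have h' : HasSum (fun k => laguerreNorm ν k (-x) * τ ^ k)
      (Real.exp τ * (cliff ν ((x * τ : ℝ) : ℂ)).re) := by
    refine h.congr_fun fun n => ?_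
    rw [← Complex.ofReal_pow, ← Complex.ofReal_mul, Complex.ofReal_re]
  exact le_hasSum h' k fun j _ =>
    mul_nonneg (laguerreNorm_neg_nonneg hν j hx) (pow_nonneg hτ j)

/-- A crude exponential bound for Laguerre polynomials. -/
theorem laguerre_neg_le {ν : ℝ} (hν : -1 / 2 < ν) (k : ℕ) {x : ℝ} (hx : 0 ≤ x) :
    Real.Gamma (k + ν + 1) * laguerreNorm ν k (-x) ≤
      (4 : ℝ) ^ (-(ν + 1)) / 5 ^ (-(ν + 1)) * 5 ^ k * Real.exp (x / 4) := by
  obtain ⟨h1, h2⟩ := gaussian_moment hν (by norm_num : (0 : ℝ) < 5) k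
  have h3 := integral_cliff_gaussian hν (by norm_num : (0 : ℝ) < 4) (x : ℂ)
  have h4 := integrable_cliff_gaussian hν (by norm_num : (0 : ℝ) < 4) (x : ℂ)
  -- One term of the positive generating series at τ = s²/2 is integrated against e^{-5τ}. The
  -- factor e^τ turns 5 into 4, and Weber's integral then yields e^{x/4}; with x = r² this is half
  -- absorbed by the e^{-r²/2} of the Laguerre function. The factor 5^k is why later series use |t|
  -- < 1/5.
  have h5 : ∫ s, laguerreNorm ν k (-x) *
      ((s ^ 2 / 2) ^ k * Real.exp (-(5 * (s ^ 2 / 2)))) ∂(muNu ν) ≤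
      ∫ s, (cliff ν ((x : ℂ) * ((s ^ 2 / 2 : ℝ) : ℂ)) *
      ((Real.exp (-(4 * (s ^ 2 / 2))) : ℝ) : ℂ)).re ∂(muNu ν) := by
    refine integral_mono (h1.const_mul _) h4.re fun s => ?_
    have h6 := laguerreNorm_neg_mul_pow_le hν k hx (by positivity : 0 ≤ s ^ 2 / 2)
    have h7 : Real.exp (-(4 * (s ^ 2 / 2))) = Real.exp (s ^ 2 / 2) *
        Real.exp (-(5 * (s ^ 2 / 2))) := by rw [← Real.exp_add]; congr 1; ring
    rw [← Complex.ofReal_mul]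
    simp only [Complex.re_mul_ofReal]
    rw [h7, ← mul_assoc, ← mul_assoc]
    refine mul_le_mul_of_nonneg_right ?_ (Real.exp_pos _).le
    linarith
  have h8 : ∫ s, (cliff ν ((x : ℂ) * ((s ^ 2 / 2 : ℝ) : ℂ)) *
      ((Real.exp (-(4 * (s ^ 2 / 2))) : ℝ) : ℂ)).re ∂(muNu ν) =
      2 ^ ν * 4 ^ (-(ν + 1)) * Real.exp (x / 4) := by
    have h9 := integral_re h4
    rw [h3] at h9
    refine h9.trans ?_
    have e : Complex.exp ((x : ℂ) / (4 : ℝ)) = ((Real.exp (x / 4) : ℝ) : ℂ) := by push_cast; rfl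
    rw [e, ← Complex.ofReal_mul]
    exact Complex.ofReal_re _
  rw [h8, integral_const_mul, h2] at h5
  have hA : (0 : ℝ) < 2 ^ ν := by positivity
  have hB : (0 : ℝ) < 5 ^ (-(ν + 1)) := by positivity
  refine le_of_mul_le_mul_left (a := 2 ^ ν * 5 ^ (-(ν + 1)) / 5 ^ k) ?_ (by positivity)
  calc _ = laguerreNorm ν k (-x) * (2 ^ ν * Real.Gamma (k + ν + 1) * (5 ^ (-(ν + 1)) / 5 ^ k)) := by
        ring
    _ ≤ _ := h5
    _ = _ := by field_simp

theorem abs_laguerre_le {ν : ℝ} (hν : -1 / 2 < ν) (k : ℕ) {x : ℝ} (hx : 0 ≤ x) :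
    |laguerre ν k x| ≤ (4 : ℝ) ^ (-(ν + 1)) / 5 ^ (-(ν + 1)) * 5 ^ k * Real.exp (x / 4) := by
  rw [laguerre_eq, abs_mul, abs_of_pos (Gamma_nat_add_pos hν k)]
  exact (mul_le_mul_of_nonneg_left (abs_laguerreNorm_le hν k hx)
    (Gamma_nat_add_pos hν k).le).trans (laguerre_neg_le hν k hx)

/-- The ordinary generating function of the Laguerre polynomials. -/
theorem hasSum_laguerre {ν : ℝ} (hν : -1 / 2 < ν) {x t : ℝ} (hx : 0 ≤ x) (ht : |t| < 1 / 5) :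
    HasSum (fun k => ((laguerre ν k x * t ^ k : ℝ) : ℂ))
      (((1 - t) ^ (-(ν + 1)) * Real.exp (-x * t / (1 - t)) : ℝ) : ℂ) := by
  have ht1 : 0 < 1 - t := by linarith [(abs_lt.mp ht).2]
  -- A Laplace transform of the exponential generating function at t s²/2: the Gaussian moments
  -- restore the factor Γ(k+ν+1).
  set F : ℕ → ℝ → ℂ := fun k s => ((laguerreNorm ν k x * t ^ k : ℝ) : ℂ) *
    (((s ^ 2 / 2) ^ k * Real.exp (-(1 * (s ^ 2 / 2))) : ℝ) : ℂ) with hF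
  have hm := fun k => gaussian_moment hν one_pos k
  have hFi : ∀ k, Integrable (F k) (muNu ν) := fun k => ((hm k).1.ofReal).const_mul _
  have h2 : (0 : ℝ) < 2 ^ ν := by positivity
  have hFs : ∀ k, ∫ s, F k s ∂(muNu ν) =
      ((2 ^ ν : ℝ) : ℂ) * ((laguerre ν k x * t ^ k : ℝ) : ℂ) := by
    intro k
    rw [hF, integral_const_mul, integral_complex_ofReal, (hm k).2, ← Complex.ofReal_mul,
      ← Complex.ofReal_mul, laguerre_eq, Real.one_rpow, one_pow]
    congr 1
    ring
  have hFn : ∀ k, ∫ s, ‖F k s‖ ∂(muNu ν) = 2 ^ ν * |laguerre ν k x * t ^ k| := by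
    intro k
    have : ∀ s, ‖F k s‖ = |laguerreNorm ν k x * t ^ k| *
        ((s ^ 2 / 2) ^ k * Real.exp (-(1 * (s ^ 2 / 2)))) := by
      intro s
      rw [hF, norm_mul, Complex.norm_real, Complex.norm_of_nonneg (by positivity), Real.norm_eq_abs]
    simp only [this]
    rw [integral_const_mul, (hm k).2, laguerre_eq, Real.one_rpow, one_pow, mul_assoc _ _ (t ^ k),
      abs_mul (Real.Gamma _), abs_of_pos (Gamma_nat_add_pos hν k)]
    ring
  have hS := hasSum_integral_of_summable_integral_norm hFi (by
    simp only [hFn]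
    refine Summable.mul_left _ ?_
    have hgeo : Summable (fun k : ℕ => (4 : ℝ) ^ (-(ν + 1)) / 5 ^ (-(ν + 1)) * Real.exp (x / 4) *
        (5 * |t|) ^ k) :=
      (summable_geometric_of_lt_one (by positivity) (by linarith)).mul_left _
    refine hgeo.of_nonneg_of_le (fun k => abs_nonneg _) fun k => ?_
    rw [abs_mul, abs_pow, mul_pow]
    calc _ ≤ ((4 : ℝ) ^ (-(ν + 1)) / 5 ^ (-(ν + 1)) * 5 ^ k * Real.exp (x / 4)) * |t| ^ k := by
          gcongr; exact abs_laguerre_le hν k hx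
      _ = _ := by ring)
  simp only [hFs] at hS
  have hpt : ∀ s : ℝ, ∑' k, F k s = cliff ν (((-x * t : ℝ) : ℂ) * ((s ^ 2 / 2 : ℝ) : ℂ)) *
      ((Real.exp (-((1 - t) * (s ^ 2 / 2))) : ℝ) : ℂ) := by
    intro s
    have h := (hasSum_laguerreNorm hν x ((t * (s ^ 2 / 2) : ℝ) : ℂ)).mul_right
      ((Real.exp (-(1 * (s ^ 2 / 2))) : ℝ) : ℂ)
    have e : (fun k => (laguerreNorm ν k x : ℂ) * ((t * (s ^ 2 / 2) : ℝ) : ℂ) ^ k *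
        ((Real.exp (-(1 * (s ^ 2 / 2))) : ℝ) : ℂ)) = fun k => F k s := by
      ext k
      simp only [hF]
      push_cast
      ring
    rw [e] at h
    rw [h.tsum_eq, ← Complex.ofReal_exp, mul_right_comm, ← Complex.ofReal_mul, ← Real.exp_add,
      mul_comm]
    congr 2
    · push_cast; ring
    · congr 1; ring
  simp only [hpt] at hS
  rw [integral_cliff_gaussian hν ht1] at hS
  have h3 := hS.mul_left (((2 ^ ν : ℝ) : ℂ)⁻¹)
  have h4 : ((2 ^ ν : ℝ) : ℂ) ≠ 0 := by exact_mod_cast h2.ne'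
  simp only [inv_mul_cancel_left₀ h4] at h3
  rw [Complex.ofReal_mul (2 ^ ν), mul_assoc, inv_mul_cancel_left₀ h4, ← Complex.ofReal_div,
    ← Complex.ofReal_exp, ← Complex.ofReal_mul] at h3
  exact h3

/-! ### Generating functions of Laguerre coefficients -/

theorem laguerreCoeff_eq (ν : ℝ) (F : ℝ → ℂ) (k : ℕ) :
    laguerreCoeff ν F k = ∫ r, F r * (psi ν k r : ℂ) ∂(muNu ν) := by
  rw [integral_muNu, laguerreCoeff]

/-- Functions that are integrable against the Gaussian `e^{-r²/4}`. -/
def GaussIntegrable (ν : ℝ) (F : ℝ → ℂ) : Prop :=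
  Integrable (fun r => F r * ((Real.exp (-(r ^ 2 / 4)) : ℝ) : ℂ)) (muNu ν)

theorem GaussIntegrable.aestronglyMeasurable {ν : ℝ} {F : ℝ → ℂ} (hF : GaussIntegrable ν F) :
    AEStronglyMeasurable F (muNu ν) := by
  have h : AEStronglyMeasurable (fun r : ℝ => ((Real.exp (r ^ 2 / 4) : ℝ) : ℂ)) (muNu ν) :=
    Continuous.aestronglyMeasurable (by fun_prop)
  refine ((Integrable.aestronglyMeasurable hF).mul h).congr (Eventually.of_forall fun r => ?_)
  simp only [Pi.mul_apply]
  rw [mul_assoc, ← Complex.ofReal_mul, ← Real.exp_add, neg_add_cancel, Real.exp_zero]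
  simp

theorem GaussIntegrable.integrable_mul {ν : ℝ} {F : ℝ → ℂ} (hF : GaussIntegrable ν F)
    {φ : ℝ → ℂ} (hφ : Continuous φ) {B : ℝ} (hB : ∀ r, ‖φ r‖ ≤ B * Real.exp (-(r ^ 2 / 4))) :
    Integrable (fun r => F r * φ r) (muNu ν) := by
  refine (hF.norm.const_mul B).mono' (hF.aestronglyMeasurable.mul hφ.aestronglyMeasurable)
    (Eventually.of_forall fun r => ?_)
  rw [norm_mul, norm_mul, Complex.norm_of_nonneg (Real.exp_pos _).le]
  calc ‖F r‖ * ‖φ r‖ ≤ ‖F r‖ * (B * Real.exp (-(r ^ 2 / 4))) := by gcongr; exact hB r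
    _ = _ := by ring

theorem GaussIntegrable.hasSum_integral {ν : ℝ} {F : ℝ → ℂ} (hF : GaussIntegrable ν F)
    {φ : ℕ → ℝ → ℂ} {Φ : ℝ → ℂ} (hφ : ∀ k, Continuous (φ k)) {B : ℕ → ℝ} (hBs : Summable B)
    (hB : ∀ k r, ‖φ k r‖ ≤ B k * Real.exp (-(r ^ 2 / 4)))
    (hΦ : ∀ r, HasSum (fun k => φ k r) (Φ r)) :
    HasSum (fun k => ∫ r, F r * φ k r ∂(muNu ν)) (∫ r, F r * Φ r ∂(muNu ν)) := by
  refine hasSum_integral_of_dominated_convergence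
    (fun k r => B k * ‖F r * ((Real.exp (-(r ^ 2 / 4)) : ℝ) : ℂ)‖)
    (fun k => (hF.integrable_mul (hφ k) (hB k)).aestronglyMeasurable)
    (fun k => Eventually.of_forall fun r => ?_)
    (Eventually.of_forall fun r => hBs.mul_right _) ?_
    (Eventually.of_forall fun r => (hΦ r).mul_left _)
  · rw [norm_mul, norm_mul, Complex.norm_of_nonneg (Real.exp_pos _).le]
    calc ‖F r‖ * ‖φ k r‖ ≤ ‖F r‖ * (B k * Real.exp (-(r ^ 2 / 4))) := by gcongr; exact hB k r
      _ = _ := by ring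
  · simp only [tsum_mul_right]
    exact hF.norm.const_mul _

/-- The constant in the crude bound for Laguerre functions. -/
noncomputable def laguerreConst (ν : ℝ) : ℝ := (4 : ℝ) ^ (-(ν + 1)) / 5 ^ (-(ν + 1))

theorem abs_psi_le {ν : ℝ} (hν : -1 / 2 < ν) (k : ℕ) (r : ℝ) :
    |psi ν k r| ≤ laguerreConst ν * 5 ^ k * Real.exp (-(r ^ 2 / 4)) := by
  rw [psi, abs_mul, abs_of_pos (Real.exp_pos _)]
  calc _ ≤ (laguerreConst ν * 5 ^ k * Real.exp (r ^ 2 / 4)) * Real.exp (-r ^ 2 / 2) := by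
        gcongr; exact abs_laguerre_le hν k (sq_nonneg r)
    _ = _ := by rw [mul_assoc _ (Real.exp _), ← Real.exp_add]; congr 2; ring

theorem continuous_psi (ν : ℝ) (k : ℕ) : Continuous (psi ν k) := by
  unfold psi laguerre; fun_prop

/-- The generating function of the Laguerre coefficients. -/
theorem GaussIntegrable.hasSum_laguerreCoeff {ν : ℝ} (hν : -1 / 2 < ν) {F : ℝ → ℂ}
    (hF : GaussIntegrable ν F) {t : ℝ} (ht : |t| < 1 / 5) :
    HasSum (fun k => laguerreCoeff ν F k * (t : ℂ) ^ k)
      (((1 - t) ^ (-(ν + 1)) : ℝ) * ∫ r, F r *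
        ((Real.exp (-((1 + t) / (1 - t) * (r ^ 2 / 2))) : ℝ) : ℂ) ∂(muNu ν)) := by
  have ht1 : 0 < 1 - t := by linarith [(abs_lt.mp ht).2]
  have h := hF.hasSum_integral (φ := fun k r => ((psi ν k r * t ^ k : ℝ) : ℂ))
    (Φ := fun r => (((1 - t) ^ (-(ν + 1)) : ℝ) : ℂ) *
      ((Real.exp (-((1 + t) / (1 - t) * (r ^ 2 / 2))) : ℝ) : ℂ))
    (B := fun k => laguerreConst ν * (5 * |t|) ^ k)
    (fun k => by have := continuous_psi ν k
                 fun_prop)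
    ((summable_geometric_of_lt_one (by positivity) (by linarith)).mul_left _)
    (fun k r => by
      rw [Complex.norm_real, Real.norm_eq_abs, abs_mul, abs_pow, mul_pow]
      calc _ ≤ (laguerreConst ν * 5 ^ k * Real.exp (-(r ^ 2 / 4))) * |t| ^ k := by
            gcongr; exact abs_psi_le hν k r
        _ = _ := by ring)
    (fun r => by
      have h1 := (hasSum_laguerre hν (sq_nonneg r) ht).mul_right
        ((Real.exp (-r ^ 2 / 2) : ℝ) : ℂ)
      have e : (((1 - t) ^ (-(ν + 1)) * Real.exp (-r ^ 2 * t / (1 - t)) : ℝ) : ℂ) *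
          ((Real.exp (-r ^ 2 / 2) : ℝ) : ℂ) = (((1 - t) ^ (-(ν + 1)) : ℝ) : ℂ) *
          ((Real.exp (-((1 + t) / (1 - t) * (r ^ 2 / 2))) : ℝ) : ℂ) := by
        rw [Complex.ofReal_mul, mul_assoc, ← Complex.ofReal_mul (Real.exp _), ← Real.exp_add]
        congr 4
        field_simp
        ring
      rw [e] at h1
      refine h1.congr_fun fun k => ?_
      rw [psi]
      push_cast
      ring)
  have e : ∫ r, F r * ((((1 - t) ^ (-(ν + 1)) : ℝ) : ℂ) *
      ((Real.exp (-((1 + t) / (1 - t) * (r ^ 2 / 2))) : ℝ) : ℂ)) ∂(muNu ν) =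
      (((1 - t) ^ (-(ν + 1)) : ℝ) : ℂ) * ∫ r, F r *
        ((Real.exp (-((1 + t) / (1 - t) * (r ^ 2 / 2))) : ℝ) : ℂ) ∂(muNu ν) := by
    rw [← integral_const_mul]
    congr 1
    ext r
    ring
  rw [e] at h
  refine h.congr_fun fun k => ?_
  rw [laguerreCoeff_eq, ← integral_mul_const]
  congr 1
  ext r
  push_cast
  ring

/-- The exponential generating function of the Laguerre coefficients. -/
theorem GaussIntegrable.hasSum_laguerreCoeff_div_Gamma {ν : ℝ} (hν : -1 / 2 < ν) {F : ℝ → ℂ}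
    (hF : GaussIntegrable ν F) (t : ℂ) :
    HasSum (fun k : ℕ => laguerreCoeff ν F k / (Real.Gamma (k + ν + 1) : ℂ) * t ^ k)
      (∫ r : ℝ, F r * (Complex.exp t * cliff ν (-(r : ℂ) ^ 2 * t) *
        ((Real.exp (-(r ^ 2 / 2)) : ℝ) : ℂ)) ∂(muNu ν)) := by
  have h := hF.hasSum_integral
    (φ := fun k r => (psi ν k r / Real.Gamma (k + ν + 1) : ℝ) * t ^ k)
    (Φ := fun r => Complex.exp t * cliff ν (-(r : ℂ) ^ 2 * t) *
        ((Real.exp (-(r ^ 2 / 2)) : ℝ) : ℂ))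
    (B := fun k => laguerreConst ν * ((5 * ‖t‖) ^ k / Real.Gamma (k + ν + 1)))
    (fun k => by have := continuous_psi ν k
                 fun_prop)
    ((summable_pow_div_Gamma hν _).mul_left _)
    (fun k r => by
      have hG := Gamma_nat_add_pos hν k
      rw [norm_mul, norm_pow, Complex.norm_real, Real.norm_eq_abs, abs_div, abs_of_pos hG, mul_pow]
      calc _ ≤ (laguerreConst ν * 5 ^ k * Real.exp (-(r ^ 2 / 4))) / Real.Gamma (k + ν + 1) *
            ‖t‖ ^ k := by gcongr; exact abs_psi_le hν k r
        _ = _ := by ring)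
    (fun r => by
      have h1 := (hasSum_laguerreNorm hν (r ^ 2) t).mul_right
        ((Real.exp (-(r ^ 2 / 2)) : ℝ) : ℂ)
      rw [Complex.ofReal_pow] at h1
      refine h1.congr_fun fun k => ?_
      have hG : Real.Gamma (k + ν + 1) ≠ 0 := (Gamma_nat_add_pos hν k).ne'
      rw [psi, laguerre_eq, neg_div, mul_assoc, mul_div_cancel_left₀ _ hG, Complex.ofReal_mul]
      ring)
  refine h.congr_fun fun k => ?_
  rw [laguerreCoeff_eq, div_eq_mul_inv, ← integral_mul_const, ← integral_mul_const]
  congr 1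
  ext r
  push_cast
  ring

/-! ### The Hankel transform and Laguerre coefficients -/

/-- The kernel of the Hankel transform. -/
noncomputable def hankelKernel (ν s r : ℝ) : ℂ :=
  ((2 ^ (-ν) : ℝ) : ℂ) * cliff ν (-((s * r : ℝ) : ℂ) ^ 2 / 4)

theorem continuous_hankelKernel {ν : ℝ} (hν : -1 / 2 < ν) :
    Continuous (fun p : ℝ × ℝ => hankelKernel ν p.1 p.2) := by
  have := continuous_cliff hν
  unfold hankelKernel
  fun_prop

theorem norm_hankelKernel_le {ν : ℝ} (hν : -1 / 2 < ν) (s r : ℝ) :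
    ‖hankelKernel ν s r‖ ≤ 2 ^ (-ν) * (1 / Real.Gamma (ν + 1)) := by
  have h := norm_cliff_sq_le_exp hν (Complex.I * (s * r : ℝ))
  rw [mul_pow, Complex.I_sq, neg_one_mul, Complex.I_mul_re, Complex.ofReal_im, neg_zero, abs_zero,
    Real.exp_zero, mul_one] at h
  rw [hankelKernel, norm_mul, Complex.norm_of_nonneg (by positivity)]
  gcongr

theorem hankel_eq {ν : ℝ} (hν : -1 / 2 < ν) (f : ℝ → ℂ) {s : ℝ} (hs : 0 < s) :
    hankel ν f s = ∫ r, f r * hankelKernel ν s r ∂(muNu ν) := by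
  rw [integral_muNu, hankel]
  refine setIntegral_congr_fun measurableSet_Ioi fun r hr => ?_
  rw [besselJ_div_rpow hν (mul_pos hs hr), hankelKernel]

theorem integrable_hankel_prod {ν : ℝ} (hν : -1 / 2 < ν) {f : ℝ → ℂ} (hf : Integrable f (muNu ν))
    {c : ℝ} (hc : 0 < c) :
    Integrable (fun p : ℝ × ℝ => f p.2 * hankelKernel ν p.1 p.2 *
      ((Real.exp (-(c * (p.1 ^ 2 / 2))) : ℝ) : ℂ)) ((muNu ν).prod (muNu ν)) := by
  have h1 : Integrable (fun p : ℝ × ℝ => ((Real.exp (-(c * (p.1 ^ 2 / 2))) : ℝ) : ℂ) * f p.2)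
      ((muNu ν).prod (muNu ν)) := (integrable_gaussian hν hc).ofReal.mul_prod hf
  have h2 := h1.bdd_mul (continuous_hankelKernel hν).aestronglyMeasurable
    (Eventually.of_forall fun p => norm_hankelKernel_le hν p.1 p.2)
  refine h2.congr (Eventually.of_forall fun p => ?_)
  simp only
  ring

theorem hankel_ae_eq {ν : ℝ} (hν : -1 / 2 < ν) (f : ℝ → ℂ) :
    ∀ᵐ s ∂(muNu ν), hankel ν f s = ∫ r, f r * hankelKernel ν s r ∂(muNu ν) := by
  filter_upwards [ae_muNu_pos ν] with s hs
  exact hankel_eq hν f hs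

/-- The Hankel kernel is bounded, so Fubini applies once a Gaussian is present. This weak
integrability is all that the Laguerre expansions of `hankel ν f` need. -/
theorem gaussIntegrable_hankel {ν : ℝ} (hν : -1 / 2 < ν) {f : ℝ → ℂ} (hf : Integrable f (muNu ν)) :
    GaussIntegrable ν (hankel ν f) := by
  have h := (integrable_hankel_prod hν hf (by norm_num : (0 : ℝ) < 1 / 2)).integral_prod_left
  refine h.congr ?_
  filter_upwards [hankel_ae_eq hν f] with s hs
  rw [hs, integral_mul_const, show 1 / 2 * (s ^ 2 / 2) = s ^ 2 / 4 by ring]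

theorem integral_hankelKernel_gaussian {ν : ℝ} (hν : -1 / 2 < ν) {c : ℝ} (hc : 0 < c) (r : ℝ) :
    ∫ s, hankelKernel ν s r * ((Real.exp (-(c * (s ^ 2 / 2))) : ℝ) : ℂ) ∂(muNu ν) =
      ((c ^ (-(ν + 1)) * Real.exp (-(1 / c * (r ^ 2 / 2))) : ℝ) : ℂ) := by
  have h := integral_cliff_gaussian hν hc (((-(r ^ 2 / 2) : ℝ)) : ℂ)
  have e : ∀ s : ℝ, hankelKernel ν s r * ((Real.exp (-(c * (s ^ 2 / 2))) : ℝ) : ℂ) =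
      ((2 ^ (-ν) : ℝ) : ℂ) * (cliff ν (((-(r ^ 2 / 2) : ℝ) : ℂ) * ((s ^ 2 / 2 : ℝ) : ℂ)) *
        ((Real.exp (-(c * (s ^ 2 / 2))) : ℝ) : ℂ)) := by
    intro s
    rw [hankelKernel, mul_assoc]
    congr 3
    push_cast
    ring
  simp only [e]
  rw [integral_const_mul, h, ← Complex.ofReal_div, ← Complex.ofReal_exp, ← Complex.ofReal_mul,
    ← Complex.ofReal_mul, Real.rpow_neg (by norm_num)]
  congr 1
  have : (0 : ℝ) < 2 ^ ν := by positivity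
  rw [show -(1 / c * (r ^ 2 / 2)) = -(r ^ 2 / 2) / c by ring]
  field_simp

/-- By Fubini the transform moves onto the Gaussian, which it maps to a Gaussian with c replaced by
1/c. -/
theorem integral_hankel_gaussian {ν : ℝ} (hν : -1 / 2 < ν) {f : ℝ → ℂ}
    (hf : Integrable f (muNu ν)) {c : ℝ} (hc : 0 < c) :
    ∫ s, hankel ν f s * ((Real.exp (-(c * (s ^ 2 / 2))) : ℝ) : ℂ) ∂(muNu ν) =
      ((c ^ (-(ν + 1)) : ℝ) : ℂ) *
        ∫ r, f r * ((Real.exp (-(1 / c * (r ^ 2 / 2))) : ℝ) : ℂ) ∂(muNu ν) := by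
  have h1 : ∫ s, hankel ν f s * ((Real.exp (-(c * (s ^ 2 / 2))) : ℝ) : ℂ) ∂(muNu ν) =
      ∫ s, ∫ r, f r * hankelKernel ν s r * ((Real.exp (-(c * (s ^ 2 / 2))) : ℝ) : ℂ) ∂(muNu ν)
        ∂(muNu ν) := by
    refine integral_congr_ae ?_
    filter_upwards [hankel_ae_eq hν f] with s hs
    rw [hs, integral_mul_const]
  rw [h1, integral_integral_swap (integrable_hankel_prod hν hf hc), ← integral_const_mul]
  congr 1
  ext r
  simp only [mul_assoc]
  rw [integral_const_mul, integral_hankelKernel_gaussian hν hc, Complex.ofReal_mul]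
  ring

theorem gaussIntegrable_of_integrable {ν : ℝ} {f : ℝ → ℂ} (hf : Integrable f (muNu ν)) :
    GaussIntegrable ν f := by
  refine hf.mul_bdd (c := 1) (Continuous.aestronglyMeasurable (by fun_prop))
    (Eventually.of_forall fun r => ?_)
  rw [Complex.norm_of_nonneg (Real.exp_pos _).le, Real.exp_le_one_iff]
  have := sq_nonneg r
  linarith

theorem eq_of_hasSum_pow {a b : ℕ → ℂ} {P : ℝ → ℂ} {ε : ℝ} (hε : 0 < ε)
    (ha : ∀ t : ℝ, |t| < ε → HasSum (fun k => a k * (t : ℂ) ^ k) (P t))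
    (hb : ∀ t : ℝ, |t| < ε → HasSum (fun k => b k * (t : ℂ) ^ k) (P t)) : a = b := by
  have key : ∀ c : ℕ → ℂ, (∀ t : ℝ, |t| < ε → HasSum (fun k => c k * (t : ℂ) ^ k) (P t)) →
      HasFPowerSeriesAt P (fun n => ContinuousMultilinearMap.mkPiRing ℝ (Fin n) (c n)) 0 := by
    intro c hc
    refine hasFPowerSeriesAt_iff.mpr ?_
    filter_upwards [Metric.ball_mem_nhds (0 : ℝ) hε] with t ht
    rw [zero_add]
    refine (hc t (by simpa using ht)).congr_fun fun k => ?_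
    simp [FormalMultilinearSeries.coeff, mul_comm]
  have h := (key a ha).eq_formalMultilinearSeries (key b hb)
  ext k
  have := congrFun (congrArg FormalMultilinearSeries.coeff h) k
  simpa [FormalMultilinearSeries.coeff] using this

/-- The Laguerre functions are eigenfunctions of the Hankel transform, in weak form. -/
theorem laguerreCoeff_hankel {ν : ℝ} (hν : -1 / 2 < ν) {f : ℝ → ℂ} (hf : Integrable f (muNu ν))
    (k : ℕ) : laguerreCoeff ν (hankel ν f) k = (-1) ^ k * laguerreCoeff ν f k := by
  have ha := fun t ht => (gaussIntegrable_hankel hν hf).hasSum_laguerreCoeff hν (t := t) ht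
  have hb : ∀ t : ℝ, |t| < 1 / 5 → HasSum (fun k => (-1) ^ k * laguerreCoeff ν f k * (t : ℂ) ^ k)
      (((1 - t) ^ (-(ν + 1)) : ℝ) * ∫ r, hankel ν f r *
        ((Real.exp (-((1 + t) / (1 - t) * (r ^ 2 / 2))) : ℝ) : ℂ) ∂(muNu ν)) := by
    intro t ht
    have ht1 : 0 < 1 - t := by linarith [(abs_lt.mp ht).2]
    have ht2 : 0 < 1 + t := by linarith [(abs_lt.mp ht).1]
    have h := (gaussIntegrable_of_integrable hf).hasSum_laguerreCoeff hν (t := -t)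
      (by rwa [abs_neg])
    -- The Gaussian parameter is c = (1+t)/(1-t), and c ↦ 1/c is t ↦ -t; the prefactors combine to
    -- (1+t)^{-(ν+1)}. So the generating function of the transform at t is that of `f` at -t.
    rw [integral_hankel_gaussian hν hf (div_pos ht2 ht1), ← mul_assoc, ← Complex.ofReal_mul,
      ← Real.mul_rpow ht1.le (div_pos ht2 ht1).le, mul_div_cancel₀ _ ht1.ne', one_div_div]
    rw [sub_neg_eq_add, ← sub_eq_add_neg] at h
    refine h.congr_fun fun k => ?_
    push_cast
    rw [neg_pow (t : ℂ)]
    ring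
  exact congrFun (eq_of_hasSum_pow (by norm_num : (0 : ℝ) < 1 / 5) ha hb) k

/-! ### Growth of the exponential generating function -/

theorem exists_rpow_le_linear {β : ℝ} (hβ0 : 0 < β) (hβ1 : β < 1) {η : ℝ} (hη : 0 < η) :
    ∃ κ : ℝ, 0 ≤ κ ∧ ∀ y : ℝ, 0 ≤ y → y ^ β ≤ η * y + κ := by
  -- The crossover point, where Y^β = ηY.
  set Y := η ^ (-(1 / (1 - β))) with hY
  have hY0 : 0 < Y := by positivity
  refine ⟨Y ^ β, by positivity, fun y hy => ?_⟩
  rcases le_total y Y with h | h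
  · have := Real.rpow_le_rpow hy h hβ0.le
    have : 0 ≤ η * y := by positivity
    linarith
  · have hy0 : 0 < y := hY0.trans_le h
    have h1 : y ^ (β - 1) ≤ Y ^ (β - 1) := Real.rpow_le_rpow_of_nonpos hY0 h (by linarith)
    have h2 : Y ^ (β - 1) = η := by
      rw [hY, ← Real.rpow_mul hη.le, show -(1 / (1 - β)) * (β - 1) = 1 by
        have : (1 - β) ≠ 0 := by linarith
        field_simp
        ring, Real.rpow_one]
    have h3 : y ^ β = y ^ (β - 1) * y := by
      rw [← Real.rpow_add_one hy0.ne']; congr 1; ring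
    have : 0 ≤ Y ^ β := by positivity
    rw [h3]
    rw [h2] at h1
    nlinarith

/-- Bound for the exponential generating function of the Laguerre coefficients of a function with
Gaussian decay up to a factor of smaller order. -/
theorem norm_integral_generating_le {ν : ℝ} (hν : -1 / 2 < ν) {p ρ D β κ C : ℝ} (hp : 0 < p)
    (hρ : 0 < ρ) (hD : 0 ≤ D) (hβ0 : 0 < β) (hβ1 : β < 1) (hκ : 0 ≤ κ) (hC : 0 ≤ C)
    (hDκ : ∀ r, D * ((r / ρ) ^ 2) ^ β ≤ r ^ 2 / 8 + κ * D) {F : ℝ → ℂ}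
    (hF : ∀ᵐ r ∂(muNu ν), ‖F r‖ ≤
      C * Real.exp (-(p * r ^ 2) / 2 + D * (1 + ((r / ρ) ^ 2) ^ β))) (t : ℂ) :
    ‖∫ r : ℝ, F r * (Complex.exp t * cliff ν (-(r : ℂ) ^ 2 * t) *
        ((Real.exp (-(r ^ 2 / 2)) : ℝ) : ℂ)) ∂(muNu ν)‖ ≤
      C * (2 ^ ν * (1 + (1 / 4) ^ (-(ν + 1)))) *
        Real.exp (((‖t‖ + t.re) + (1 - p) / (1 + p) * (‖t‖ - t.re)) / 2 +
          (17 + κ) * D * (1 + (‖t‖ / (ρ ^ 2 / 4)) ^ β)) := by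
  -- This writes -r²t as (rz)²/4, the form required by the Poisson bounds. Only |Re z| enters, and
  -- its square is 2(|t| - Re t).
  obtain ⟨z, hz⟩ : ∃ z : ℂ, z ^ 2 = -4 * t := IsAlgClosed.exists_pow_nat_eq _ two_pos
  set X := |z.re| with hXdef
  have hX0 : 0 ≤ X := abs_nonneg _
  have hX2 : X ^ 2 = 2 * (‖t‖ - t.re) := by
    have h1 : ‖z‖ ^ 2 = 4 * ‖t‖ := by rw [← norm_pow, hz, norm_mul, norm_neg]; norm_num
    rw [Complex.sq_norm, Complex.normSq_apply] at h1
    have h2 := congrArg Complex.re hz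
    rw [sq, Complex.mul_re, show (-4 * t : ℂ) = ((-4 : ℝ) : ℂ) * t by push_cast; ring,
      Complex.re_ofReal_mul] at h2
    rw [hXdef, sq_abs]
    nlinarith
  have hX4 : X ^ 2 ≤ 4 * ‖t‖ := by
    have := (abs_le.mp (Complex.abs_re_le_norm t)).1
    linarith
  have harg : ∀ r : ℝ, -(r : ℂ) ^ 2 * t = (r * z) ^ 2 / 4 := by
    intro r; rw [mul_pow, hz]; ring
  set c := 1 + p with hc
  have hc1 : 1 ≤ c := by linarith
  have hc0 : 0 < c := by linarith
  set y : ℂ := ((X ^ 2 / 2 : ℝ) : ℂ) with hy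
  have hcl1 : ∀ r : ℝ, ‖cliff ν (-(r : ℂ) ^ 2 * t)‖ ≤
      (cliff ν (y * ((r ^ 2 / 2 : ℝ) : ℂ))).re := by
    intro r
    rw [harg]
    refine (norm_cliff_sq_le_re hν _).trans (le_of_eq ?_)
    congr 2
    rw [Complex.re_ofReal_mul, hy, hXdef, sq_abs]
    push_cast
    ring
  have hcl2 : ∀ r : ℝ, 0 < r → ‖cliff ν (-(r : ℂ) ^ 2 * t)‖ ≤
      1 / Real.Gamma (ν + 1) * Real.exp (r * X) := by
    intro r hr
    rw [harg]
    refine (norm_cliff_sq_le_exp hν _).trans (le_of_eq ?_)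
    rw [Complex.re_ofReal_mul, abs_mul, abs_of_pos hr]
  have hG0 : 0 < Real.Gamma (ν + 1) := Real.Gamma_pos_of_pos (by linarith)
  set S := ((4 * X / ρ) ^ 2) ^ β with hS
  have hS0 : 0 ≤ S := by positivity
  have hI1 := integrable_cliff_gaussian hν hc0 y
  have hI1re : Integrable (fun r : ℝ => (cliff ν (y * ((r ^ 2 / 2 : ℝ) : ℂ)) *
      ((Real.exp (-(c * (r ^ 2 / 2))) : ℝ) : ℂ)).re) (muNu ν) := hI1.re
  have hI2 := integrable_gaussian hν (by norm_num : (0 : ℝ) < 1 / 4)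
  have hv1 : ∫ r : ℝ, (cliff ν (y * ((r ^ 2 / 2 : ℝ) : ℂ)) *
      ((Real.exp (-(c * (r ^ 2 / 2))) : ℝ) : ℂ)).re ∂(muNu ν) ≤
      2 ^ ν * Real.exp (X ^ 2 / 2 / c) := by
    have h1 := integral_re hI1
    rw [integral_cliff_gaussian hν hc0 y] at h1
    refine (h1.trans ?_).le.trans (?_ : 2 ^ ν * c ^ (-(ν + 1)) * Real.exp (X ^ 2 / 2 / c) ≤ _)
    · rw [hy, ← Complex.ofReal_div, ← Complex.ofReal_exp, ← Complex.ofReal_mul]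
      exact Complex.ofReal_re _
    · gcongr
      exact mul_le_of_le_one_right (by positivity)
        (Real.rpow_le_one_of_one_le_of_nonpos hc1 (by linarith))
  have hv2 : ∫ r : ℝ, Real.exp (-(1 / 4 * (r ^ 2 / 2))) ∂(muNu ν) =
      2 ^ ν * Real.Gamma (ν + 1) * (1 / 4) ^ (-(ν + 1)) := by
    simpa using (gaussian_moment hν (by norm_num : (0 : ℝ) < 1 / 4) 0).2
  set G : ℝ → ℝ := fun r => C * Real.exp t.re * (Real.exp (D + D * S) *
    (cliff ν (y * ((r ^ 2 / 2 : ℝ) : ℂ)) * ((Real.exp (-(c * (r ^ 2 / 2))) : ℝ) : ℂ)).re +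
    Real.exp (D + κ * D) * (1 / Real.Gamma (ν + 1)) * Real.exp (-(1 / 4 * (r ^ 2 / 2)))) with hG
  have hGi : Integrable G (muNu ν) :=
    ((hI1re.const_mul _).add (hI2.const_mul _)).const_mul _
  have hdom : ∀ᵐ r ∂(muNu ν), ‖F r * (Complex.exp t * cliff ν (-(r : ℂ) ^ 2 * t) *
        ((Real.exp (-(r ^ 2 / 2)) : ℝ) : ℂ))‖ ≤ G r := by
    filter_upwards [hF, ae_muNu_pos ν] with r hFr hr
    have hpos1 : 0 ≤ (cliff ν (y * ((r ^ 2 / 2 : ℝ) : ℂ))).re := (norm_nonneg _).trans (hcl1 r)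
    rw [norm_mul, norm_mul, norm_mul, Complex.norm_exp, Complex.norm_of_nonneg (Real.exp_pos _).le]
    simp only [hG, Complex.re_mul_ofReal]
    have hkey : Real.exp (-(p * r ^ 2) / 2 + D * (1 + ((r / ρ) ^ 2) ^ β)) *
        ‖cliff ν (-(r : ℂ) ^ 2 * t)‖ * Real.exp (-(r ^ 2 / 2)) ≤ Real.exp (D + D * S) *
        ((cliff ν (y * ((r ^ 2 / 2 : ℝ) : ℂ))).re * Real.exp (-(c * (r ^ 2 / 2)))) +
        Real.exp (D + κ * D) * (1 / Real.Gamma (ν + 1)) * Real.exp (-(1 / 4 * (r ^ 2 / 2))) := by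
      -- For r ≤ 4X the perturbation is frozen at its value at 4X and Weber's integral applies, with
      -- no polynomial loss in |t|. For r ≥ 4X one has rX ≤ r²/4 and the perturbation costs at most
      -- r²/8 + κD beyond D, leaving e^{-r²/8} of the factor e^{-r²/2}.
      rcases le_total r (4 * X) with h | h
      · refine le_trans ?_ (le_add_of_nonneg_right (by positivity))
        have h1 : ((r / ρ) ^ 2) ^ β ≤ S := by
          refine Real.rpow_le_rpow (by positivity) ?_ hβ0.le
          gcongr
        calc _ ≤ Real.exp (-(p * r ^ 2) / 2 + D * (1 + S)) *
              (cliff ν (y * ((r ^ 2 / 2 : ℝ) : ℂ))).re * Real.exp (-(r ^ 2 / 2)) := by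
              gcongr
              exact hcl1 r
          _ = (Real.exp (-(p * r ^ 2) / 2 + D * (1 + S)) * Real.exp (-(r ^ 2 / 2))) *
              (cliff ν (y * ((r ^ 2 / 2 : ℝ) : ℂ))).re := by ring
          _ = (Real.exp (D + D * S) * Real.exp (-(c * (r ^ 2 / 2)))) *
              (cliff ν (y * ((r ^ 2 / 2 : ℝ) : ℂ))).re := by
              rw [← Real.exp_add, ← Real.exp_add, hc]
              congr 2
              ring
          _ = _ := by ring
      · refine le_trans ?_ (le_add_of_nonneg_left (by positivity))
        calc _ ≤ Real.exp (-(p * r ^ 2) / 2 + D * (1 + ((r / ρ) ^ 2) ^ β)) *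
              (1 / Real.Gamma (ν + 1) * Real.exp (r * X)) * Real.exp (-(r ^ 2 / 2)) := by
              gcongr
              exact hcl2 r hr
          _ = Real.exp (-(p * r ^ 2) / 2 + D * (1 + ((r / ρ) ^ 2) ^ β) + r * X + -(r ^ 2 / 2)) *
              (1 / Real.Gamma (ν + 1)) := by
              rw [Real.exp_add (_ + _ + _), Real.exp_add (_ + _)]
              ring
          _ ≤ Real.exp (D + κ * D + -(1 / 4 * (r ^ 2 / 2))) * (1 / Real.Gamma (ν + 1)) := by
              refine mul_le_mul_of_nonneg_right (Real.exp_le_exp.mpr ?_) (by positivity)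
              have h1 := hDκ r
              have h2 : r * X ≤ r ^ 2 / 4 := by nlinarith
              have h3 : 0 ≤ p * r ^ 2 := by positivity
              linarith
          _ = _ := by rw [Real.exp_add]; ring
    calc _ ≤ (C * Real.exp (-(p * r ^ 2) / 2 + D * (1 + ((r / ρ) ^ 2) ^ β))) *
          (Real.exp t.re * ‖cliff ν (-(r : ℂ) ^ 2 * t)‖ * Real.exp (-(r ^ 2 / 2))) := by gcongr
      _ = C * Real.exp t.re * (Real.exp (-(p * r ^ 2) / 2 + D * (1 + ((r / ρ) ^ 2) ^ β)) *
        ‖cliff ν (-(r : ℂ) ^ 2 * t)‖ * Real.exp (-(r ^ 2 / 2))) := by ring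
      _ ≤ _ := by gcongr
  refine (norm_integral_le_of_norm_le hGi hdom).trans ?_
  have hGint : ∫ r, G r ∂(muNu ν) ≤ C * Real.exp t.re * (Real.exp (D + D * S) *
      (2 ^ ν * Real.exp (X ^ 2 / 2 / c)) + Real.exp (D + κ * D) * (1 / Real.Gamma (ν + 1)) *
      (2 ^ ν * Real.Gamma (ν + 1) * (1 / 4) ^ (-(ν + 1)))) := by
    rw [hG, integral_const_mul, integral_add (hI1re.const_mul _) (hI2.const_mul _),
      integral_const_mul, integral_const_mul, hv2]
    gcongr
  refine hGint.trans ?_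
  have hST : S ≤ 16 * (‖t‖ / (ρ ^ 2 / 4)) ^ β := by
    have h1 : (4 * X / ρ) ^ 2 ≤ 16 * (‖t‖ / (ρ ^ 2 / 4)) := by
      rw [div_pow, mul_pow, show 16 * (‖t‖ / (ρ ^ 2 / 4)) = (4 ^ 2 * (4 * ‖t‖)) / ρ ^ 2 by
        field_simp; ring]
      gcongr
    calc S ≤ (16 * (‖t‖ / (ρ ^ 2 / 4))) ^ β := Real.rpow_le_rpow (by positivity) h1 hβ0.le
      _ = 16 ^ β * (‖t‖ / (ρ ^ 2 / 4)) ^ β := Real.mul_rpow (by norm_num) (by positivity)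
      _ ≤ 16 ^ (1 : ℝ) * (‖t‖ / (ρ ^ 2 / 4)) ^ β := by
        gcongr
        norm_num
      _ = _ := by rw [Real.rpow_one]
  set P := (‖t‖ / (ρ ^ 2 / 4)) ^ β with hP
  have hP0 : 0 ≤ P := by positivity
  -- Weber's exponent is (|t| - Re t)/(1+p), and 1/(1+p) is half of 1 + (1-p)/(1+p).
  have hexp : t.re + X ^ 2 / 2 / c =
      ((‖t‖ + t.re) + (1 - p) / (1 + p) * (‖t‖ - t.re)) / 2 := by
    rw [hX2, ← hc]
    have : p = c - 1 := by rw [hc]; ring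
    rw [this]
    field_simp
    ring
  set E := t.re + X ^ 2 / 2 / c with hE
  rw [← hexp]
  have hA : Real.exp t.re * (Real.exp (D + D * S) * Real.exp (X ^ 2 / 2 / c)) ≤
      Real.exp (E + (17 + κ) * D * (1 + P)) := by
    rw [← Real.exp_add, ← Real.exp_add]
    refine Real.exp_le_exp.mpr ?_
    have h1 : D * S ≤ D * (16 * P) := by gcongr
    have h2 : 0 ≤ κ * D := by positivity
    have h3 : 0 ≤ κ * D * P := by positivity
    have h4 : 0 ≤ D * P := by positivity
    linarith
  have hB : Real.exp t.re * Real.exp (D + κ * D) ≤ Real.exp (E + (17 + κ) * D * (1 + P)) := by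
    rw [← Real.exp_add]
    refine Real.exp_le_exp.mpr ?_
    have h2 : 0 ≤ X ^ 2 / 2 / c := by positivity
    have h3 : 0 ≤ κ * D * P := by positivity
    have h4 : 0 ≤ D * P := by positivity
    linarith
  calc _ = C * (2 ^ ν * (Real.exp t.re * (Real.exp (D + D * S) * Real.exp (X ^ 2 / 2 / c)) +
        (Real.exp t.re * Real.exp (D + κ * D)) * (1 / 4) ^ (-(ν + 1)))) := by
        field_simp
    _ ≤ C * (2 ^ ν * (Real.exp (E + (17 + κ) * D * (1 + P)) +
        Real.exp (E + (17 + κ) * D * (1 + P)) * (1 / 4) ^ (-(ν + 1)))) := by gcongr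
    _ = _ := by ring

/-! ### Coefficient estimates and the Young conjugate -/

theorem norm_coeff_le {g : ℂ → ℂ} {b : ℕ → ℂ} (hg : ∀ t, HasSum (fun k => b k * t ^ k) (g t)) :
    Differentiable ℂ g ∧ ∀ (R M : ℝ), 0 < R → (∀ t, ‖t‖ = R → ‖g t‖ ≤ M) → ∀ k,
      ‖b k‖ ≤ M / R ^ k := by
  have hd : Differentiable ℂ g := by
    have hgt : g = fun t => ∑' k, b k * t ^ k := by ext t; exact (hg t).tsum_eq.symm
    have : ∀ R : ℝ, DifferentiableOn ℂ g (Metric.ball 0 R) := by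
      intro R
      rw [hgt]
      refine Complex.differentiableOn_tsum_of_summable_norm (u := fun k => ‖b k * (R : ℂ) ^ k‖)
        (hg R).summable.norm (fun k => by fun_prop) Metric.isOpen_ball fun k t ht => ?_
      rw [norm_mul, norm_mul, norm_pow, norm_pow, Complex.norm_real]
      have : ‖t‖ ≤ ‖R‖ := (mem_ball_zero_iff.mp ht).le.trans (le_abs_self R)
      gcongr
    intro t
    exact (this (‖t‖ + 1)).differentiableAt (Metric.isOpen_ball.mem_nhds (by simp))
  refine ⟨hd, fun R M hR hM k => ?_⟩
  have h1 : HasFPowerSeriesAt g (fun n => ContinuousMultilinearMap.mkPiRing ℂ (Fin n) (b n)) 0 := by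
    refine hasFPowerSeriesAt_iff.mpr (Eventually.of_forall fun t => ?_)
    rw [zero_add]
    refine (hg t).congr_fun fun k => ?_
    simp [FormalMultilinearSeries.coeff, mul_comm]
  lift R to NNReal using hR.le
  have h2 := (hd.hasFPowerSeriesOnBall (R := R) 0 (by exact_mod_cast hR)).hasFPowerSeriesAt
  have h3 := h1.eq_formalMultilinearSeries h2
  have h4 : ‖b k‖ = ‖cauchyPowerSeries g 0 R k‖ := by
    rw [← h3]; simp
  rw [h4]
  refine (norm_cauchyPowerSeries_le g 0 R k).trans ?_
  have h5 : ∫ θ in (0 : ℝ)..2 * Real.pi, ‖g (circleMap 0 R θ)‖ ≤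
      ∫ _ in (0 : ℝ)..2 * Real.pi, M := by
    refine intervalIntegral.integral_mono_on (by positivity) ?_ (by simp) fun θ _ => ?_
    · exact Continuous.intervalIntegrable (by have := hd.continuous
                                              fun_prop) _ _
    · exact hM _ (by simp)
  rw [intervalIntegral.integral_const, smul_eq_mul, sub_zero] at h5
  have hpi := Real.pi_pos
  calc _ ≤ ((2 * Real.pi)⁻¹ * (2 * Real.pi * M)) * |(R : ℝ)|⁻¹ ^ k := by gcongr
    _ = M / (R : ℝ) ^ k := by
      rw [abs_of_pos hR, inv_mul_cancel_left₀ (by positivity), inv_pow, div_eq_mul_inv]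

theorem GaussBound.const_nonneg {p q lam C : ℝ} {w : ℝ → ℝ} {f : ℝ → ℂ}
    (h : GaussBound p q lam w C f) : 0 ≤ C := by
  by_contra! hC
  have hne : NeBot (ae (volume.restrict (Ioi (0 : ℝ)))) := by
    rw [ae_neBot, Ne, Measure.restrict_eq_zero]
    simp
  obtain ⟨r, hr⟩ := h.exists
  have := mul_neg_of_neg_of_pos hC (Real.exp_pos (-(p * r ^ 2) / 2 + lam * w (q * r)))
  exact absurd (norm_nonneg (f r)) (by linarith)

theorem GaussBound.mono {p p' q lam C : ℝ} {w : ℝ → ℝ} {f : ℝ → ℂ} (hp : p' ≤ p)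
    (h : GaussBound p q lam w C f) : GaussBound p' q lam w C f := by
  have hC := h.const_nonneg
  filter_upwards [h] with r hr
  refine hr.trans ?_
  gcongr

/-- Bound of the Laguerre coefficients with a free radius. -/
theorem exists_norm_laguerreCoeff_le {w : ℝ → ℝ} (hw : IsWeight w) (hg : GrowthCondition w)
    {ν q lam : ℝ} (hν : -1 / 2 < ν) (hq : 0 < q) (hlam : 0 < lam) :
    ∃ L K : ℝ, 1 ≤ L ∧ 0 < K ∧ ∀ p : ℝ, 0 < p → p < 1 → ∀ f : ℝ → ℂ, Integrable f (muNu ν) →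
      ∀ C : ℝ, GaussBound p q lam w C f → GaussBound p q lam w C (hankel ν f) →
      ∀ (k : ℕ) (ρ : ℝ), 1 / q ≤ ρ → ‖laguerreCoeff ν f k‖ ≤
        K * C * (4 ^ k * Real.Gamma (k + ν + 1)) / ρ ^ (2 * k) *
          Real.exp (Real.sqrt ((1 - p) / (1 + p)) * (ρ ^ 2 / 4) + L * w (q * ρ)) := by
  obtain ⟨A, β, hA, hβ0, hβ1, hpow⟩ := hg.exists_power_bound hw
  -- Chosen so that D ≤ D₀ρ² for all ρ ≥ 1/q, by the power bound from the base point 1. Then κ,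
  -- taken for the slope 1/(8(D₀+1)), works for every radius at once; neither depends on p.
  set D₀ := lam * A * (1 + 2 * A * (1 + w 1)) * q ^ 2 with hD₀
  have hw1 := hw.nonneg 1 zero_le_one
  have hD₀0 : 0 ≤ D₀ := by positivity
  obtain ⟨κ, hκ0, hκ⟩ := exists_rpow_le_linear hβ0 hβ1
    (by positivity : 0 < 1 / (8 * (D₀ + 1)))
  set γ := Real.cos (β * (Real.pi / 2)) with hγ
  have hγ0 : 0 < γ := Real.cos_pos_of_mem_Ioo
    ⟨by nlinarith [Real.pi_pos], by nlinarith [Real.pi_pos]⟩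
  set c₂ := (17 + κ) * (2 + 1 / γ) * (lam * A) with hc₂
  have hc₂0 : 0 < c₂ := by positivity
  set K₀ : ℝ := 2 ^ ν * (1 + (1 / 4) ^ (-(ν + 1))) with hK₀
  have hK₀0 : 0 < K₀ := by positivity
  refine ⟨max 1 c₂, K₀ * Real.exp c₂, le_max_left _ _, by positivity, ?_⟩
  intro p hp0 hp1 f hf C hb1 hb2 k ρ hρ
  have hC := hb1.const_nonneg
  have hρ0 : 0 < ρ := lt_of_lt_of_le (by positivity) hρ
  have hqρ : 1 ≤ q * ρ := by rwa [div_le_iff₀' hq] at hρ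
  have hwq := hw.nonneg (q * ρ) (by linarith)
  set D := lam * A * (1 + w (q * ρ)) with hD
  have hD0 : 0 ≤ D := by positivity
  have hDD₀ : D ≤ D₀ * ρ ^ 2 := by
    have h1 := hpow 1 (q * ρ) le_rfl (by linarith)
    have h3 : 1 ≤ (q * ρ) ^ 2 := one_le_pow₀ hqρ
    have h2 : ((q * ρ / 1) ^ 2) ^ β ≤ (q * ρ) ^ 2 := by
      rw [div_one]
      calc ((q * ρ) ^ 2) ^ β ≤ ((q * ρ) ^ 2) ^ (1 : ℝ) :=
            Real.rpow_le_rpow_of_exponent_le h3 hβ1.le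
        _ = _ := Real.rpow_one _
    calc D ≤ lam * A * (1 * (q * ρ) ^ 2 + A * (1 + w 1) * ((q * ρ) ^ 2 + (q * ρ) ^ 2)) := by
          rw [hD]
          gcongr
          · linarith
          · refine h1.trans ?_
            gcongr
      _ = D₀ * ρ ^ 2 := by rw [hD₀]; ring
  have hDκ : ∀ r : ℝ, D * ((r / ρ) ^ 2) ^ β ≤ r ^ 2 / 8 + κ * D := by
    intro r
    have h1 := hκ ((r / ρ) ^ 2) (sq_nonneg _)
    calc D * ((r / ρ) ^ 2) ^ β ≤ D * (1 / (8 * (D₀ + 1)) * (r / ρ) ^ 2 + κ) := by gcongr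
      _ = D * (1 / (8 * (D₀ + 1)) * (r / ρ) ^ 2) + κ * D := by ring
      _ ≤ ((D₀ + 1) * ρ ^ 2) * (1 / (8 * (D₀ + 1)) * (r / ρ) ^ 2) + κ * D := by
          gcongr
          refine hDD₀.trans ?_
          gcongr
          linarith
      _ = r ^ 2 / 8 + κ * D := by field_simp
  have hbound : ∀ F : ℝ → ℂ, GaussBound p q lam w C F → ∀ᵐ r ∂(muNu ν), ‖F r‖ ≤
      C * Real.exp (-(p * r ^ 2) / 2 + D * (1 + ((r / ρ) ^ 2) ^ β)) := by
    intro F hF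
    filter_upwards [ae_muNu hF, ae_muNu_pos ν] with r hr hr0
    refine hr.trans (mul_le_mul_of_nonneg_left (Real.exp_le_exp.mpr (add_le_add le_rfl ?_)) hC)
    have h1 := hpow (q * ρ) (q * r) hqρ (by positivity)
    rw [mul_div_mul_left _ _ hq.ne'] at h1
    calc lam * w (q * r) ≤ lam * (A * (1 + w (q * ρ)) * (1 + ((r / ρ) ^ 2) ^ β)) := by gcongr
      _ = _ := by rw [hD]; ring
  -- On this circle the relative growth factor (|t|/T)^β is 1, so the weight contributes only a
  -- multiple of 1 + w(qρ).
  set T := ρ ^ 2 / 4 with hT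
  have hT0 : 0 < T := by positivity
  have hGam := Gamma_nat_add_pos hν
  set b : ℕ → ℂ := fun k => laguerreCoeff ν f k / (Real.Gamma (k + ν + 1) : ℂ) with hb
  set g : ℂ → ℂ := fun t => ∫ r : ℝ, f r * (Complex.exp t * cliff ν (-(r : ℂ) ^ 2 * t) *
        ((Real.exp (-(r ^ 2 / 2)) : ℝ) : ℂ)) ∂(muNu ν) with hgdef
  have hgs : ∀ t, HasSum (fun k => b k * t ^ k) (g t) := fun t =>
    (gaussIntegrable_of_integrable hf).hasSum_laguerreCoeff_div_Gamma hν t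
  have hgneg : ∀ t, g (-t) = ∫ r : ℝ, hankel ν f r * (Complex.exp t *
      cliff ν (-(r : ℂ) ^ 2 * t) * ((Real.exp (-(r ^ 2 / 2)) : ℝ) : ℂ)) ∂(muNu ν) := by
    intro t
    refine HasSum.unique ((hgs (-t)).congr_fun fun k => ?_)
      ((gaussIntegrable_hankel hν hf).hasSum_laguerreCoeff_div_Gamma hν t)
    rw [hb, laguerreCoeff_hankel hν hf, neg_pow t]
    ring
  obtain ⟨hgd, hcoeff⟩ := norm_coeff_le hgs
  set a := (1 - p) / (1 + p) with ha
  have ha0 : 0 < a := div_pos (by linarith) (by linarith)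
  have ha1 : a < 1 := by rw [ha, div_lt_one (by linarith)]; linarith
  have h1 := fun t => norm_integral_generating_le hν hp0 hρ0 hD0 hβ0 hβ1 hκ0 hC hDκ
    (hbound f hb1) t
  have h2 := fun t => norm_integral_generating_le hν hp0 hρ0 hD0 hβ0 hβ1 hκ0 hC hDκ
    (hbound _ hb2) t
  have hmain : ∀ t : ℂ, ‖t‖ = T → ‖g t‖ ≤ C * K₀ * Real.exp (Real.sqrt a * T +
      (17 + κ) * D * (2 + 1 / γ)) := fun t ht =>
    norm_le_of_entire hgd hT0 (by positivity) hβ0 hβ1 ha0 ha1 (by positivity) h1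
      (fun t => by
        have := h2 (-t)
        rw [← hgneg, neg_neg, norm_neg, Complex.neg_re, sub_neg_eq_add, ← sub_eq_add_neg] at this
        exact this) ht
  have h3 := hcoeff T _ hT0 hmain k
  rw [hb, norm_div, Complex.norm_of_nonneg (hGam k).le, div_le_iff₀ (hGam k)] at h3
  refine h3.trans ?_
  have hTk : T ^ k = ρ ^ (2 * k) / 4 ^ k := by rw [hT, div_pow, ← pow_mul]
  have hexp : Real.exp (Real.sqrt a * T + (17 + κ) * D * (2 + 1 / γ)) ≤
      Real.exp c₂ * Real.exp (Real.sqrt a * T + max 1 c₂ * w (q * ρ)) := by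
    rw [← Real.exp_add]
    refine Real.exp_le_exp.mpr ?_
    have : c₂ * w (q * ρ) ≤ max 1 c₂ * w (q * ρ) := by
      gcongr; exact le_max_right _ _
    have e : (17 + κ) * D * (2 + 1 / γ) = c₂ + c₂ * w (q * ρ) := by rw [hD, hc₂]; ring
    linarith
  rw [hTk]
  calc _ ≤ C * K₀ * (Real.exp c₂ * Real.exp (Real.sqrt a * T + max 1 c₂ * w (q * ρ))) /
        (ρ ^ (2 * k) / 4 ^ k) * Real.Gamma (k + ν + 1) := by
        have := (hGam k).le
        gcongr
    _ = _ := by field_simp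

/-- Passing from pointwise bounds to the Young conjugate. -/
theorem ofReal_le_decayBound {ν q l B x : ℝ} {φ : ℝ → ℝ} {k : ℕ} (hν : -1 / 2 < ν) (hl : 0 < l)
    (hB : 0 ≤ B) (h : ∀ u : ℝ, 0 ≤ u → x ≤ B * (2 ^ (2 * k) * Real.Gamma (k + ν + 1)) *
      Real.exp (2 * k * Real.log q - 1 / l * (u * (2 * l * k) - φ u))) :
    ENNReal.ofReal x ≤ ENNReal.ofReal B * decayBound ν q l φ k := by
  -- When x > 0 the pointwise bounds force the conjugate to be finite, so an infinite conjugate can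
  -- only occur in the trivial case.
  rcases le_or_gt x 0 with hx | hx
  · rw [ENNReal.ofReal_of_nonpos hx]; exact zero_le
  have hG := Gamma_nat_add_pos hν k
  set W := B * (2 ^ (2 * k) * Real.Gamma (k + ν + 1)) with hW
  have hW0 : 0 < W := by
    rcases (by positivity : 0 ≤ W).eq_or_lt with h0 | h0
    · have := h 0 le_rfl
      rw [← h0, zero_mul] at this
      linarith
    · exact h0
  have hlog : ∀ u : ℝ, 0 ≤ u →
      u * (2 * l * k) - φ u ≤ l * (2 * k * Real.log q - Real.log (x / W)) := by
    intro u hu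
    have h1 : x / W ≤ Real.exp (2 * k * Real.log q - 1 / l * (u * (2 * l * k) - φ u)) := by
      rw [div_le_iff₀' hW0]; exact h u hu
    have h2 := (Real.log_le_iff_le_exp (div_pos hx hW0)).mpr h1
    rw [← div_le_iff₀' hl]
    have h3 : (u * (2 * l * k) - φ u) / l = 1 / l * (u * (2 * l * k) - φ u) := by ring
    linarith
  have hup : youngConj φ (2 * l * k) ≤
      ((l * (2 * k * Real.log q - Real.log (x / W)) : ℝ) : EReal) :=
    iSup₂_le fun u hu => EReal.coe_le_coe_iff.mpr (hlog u hu)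
  have hlow : ((0 * (2 * l * k) - φ 0 : ℝ) : EReal) ≤ youngConj φ (2 * l * k) :=
    le_iSup₂_of_le 0 le_rfl le_rfl
  rw [decayBound]
  generalize youngConj φ (2 * l * k) = S at hup hlow
  induction S with
  | bot => exact absurd hlow (not_le.mpr (EReal.bot_lt_coe _))
  | top => exact absurd hup (not_le.mpr (EReal.coe_lt_top _))
  | coe s =>
    have hs := EReal.coe_le_coe_iff.mp hup
    rw [← EReal.coe_mul, ← EReal.coe_sub, EReal.exp_coe, ← mul_assoc, ← ENNReal.ofReal_mul hB,
      ← ENNReal.ofReal_mul hW0.le]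
    refine ENNReal.ofReal_le_ofReal ?_
    have h1 : Real.log (x / W) ≤ 2 * k * Real.log q - 1 / l * s := by
      rw [← div_le_iff₀' hl] at hs
      have h3 : s / l = 1 / l * s := by ring
      linarith
    rw [← div_le_iff₀' hW0]
    exact (Real.log_le_iff_le_exp (div_pos hx hW0)).mp h1

/-- The radius ρ = e^u/q makes qρ = e^u, so that w(qρ) becomes φ(u) and ρ^{-2k} becomes e^{2k log q
- 2ku}. -/
theorem coeff_bound_at_exp {B q u : ℝ} (hq : 0 < q) (k : ℕ) (G e : ℝ) :
    B * (4 ^ k * G) / (Real.exp u / q) ^ (2 * k) * Real.exp e =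
      B * (2 ^ (2 * k) * G) * Real.exp (2 * k * Real.log q - (2 * k * u - e)) := by
  have h1 : Real.exp (2 * k * Real.log q - (2 * k * u - e)) =
      q ^ (2 * k) / Real.exp u ^ (2 * k) * Real.exp e := by
    rw [show 2 * k * Real.log q - (2 * k * u - e) =
      ((2 * k : ℕ) : ℝ) * Real.log q - ((2 * k : ℕ) : ℝ) * u + e by push_cast; ring,
      Real.exp_add, Real.exp_sub, Real.exp_nat_mul, Real.exp_nat_mul, Real.exp_log hq]
  rw [h1, div_pow, show (4 : ℝ) ^ k = 2 ^ (2 * k) by rw [pow_mul]; norm_num]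
  field_simp

end HankelHardy

/-! ### The two decay estimates -/

theorem theorem5p1 (w : ℝ → ℝ) (hw : HankelHardy.IsWeight w)
    (hgrowth : HankelHardy.GrowthCondition w)
    (ν q lam : ℝ) (hν : -1 / 2 < ν) (hq : 0 < q) (hlam : 0 < lam) :
    (∃ l : ℝ, 0 < l ∧ ∃ K : ℝ, 0 < K ∧
      ∀ p : ℝ, 1 ≤ p → ∀ f ∈ HankelHardy.hardyClass ν p q lam w, ∀ C : ℝ,
        HankelHardy.GaussBound p q lam w C f →
        HankelHardy.GaussBound p q lam w C (HankelHardy.hankel ν f) →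
        ∀ k : ℕ, ENNReal.ofReal ‖HankelHardy.laguerreCoeff ν f k‖ ≤
          ENNReal.ofReal (K * C) *
            HankelHardy.decayBound ν q l (HankelHardy.phi w) k) ∧
    (∃ l : ℝ, 0 < l ∧ ∃ K : ℝ, 0 < K ∧
      ∀ p : ℝ, 0 < p → p < 1 → ∀ f ∈ HankelHardy.hardyClass ν p q lam w, ∀ C : ℝ,
        HankelHardy.GaussBound p q lam w C f →
        HankelHardy.GaussBound p q lam w C (HankelHardy.hankel ν f) →
        ∀ k : ℕ, ENNReal.ofReal ‖HankelHardy.laguerreCoeff ν f k‖ ≤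
          ENNReal.ofReal (K * C) *
            HankelHardy.decayBound ν q l (HankelHardy.zeta w p q) k) := by
  obtain ⟨L, K, hL, hK, hmain⟩ :=
    HankelHardy.exists_norm_laguerreCoeff_le hw hgrowth hν hq hlam
  have hL0 : 0 < L := by linarith
  have hradius : ∀ u : ℝ, 0 ≤ u → 1 / q ≤ Real.exp u / q := fun u hu => by
    gcongr; exact Real.one_le_exp hu
  have hqexp : ∀ u : ℝ, q * (Real.exp u / q) = Real.exp u := fun u => mul_div_cancel₀ _ hq.ne'
  -- The choice l = 1/L turns the coefficient L of the weight into the factor 1/l in front of the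
  -- conjugate.
  have hlin : ∀ (k : ℕ) (u s : ℝ), 1 / (1 / L) * (u * (2 * (1 / L) * k) - s) =
      2 * k * u - L * s := by
    intro k u s; field_simp
  refine ⟨⟨1 / L, by positivity, K, hK, fun p hp f hf C hb1 hb2 k => ?_⟩,
    ⟨1 / L, by positivity, K, hK, fun p hp0 hp1 f hf C hb1 hb2 k => ?_⟩⟩
  · have hC := hb1.const_nonneg
    refine HankelHardy.ofReal_le_decayBound hν (by positivity) (by positivity) fun u hu => ?_
    rw [hlin, HankelHardy.phi, ← HankelHardy.coeff_bound_at_exp hq]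
    -- The bound is available only for p' < 1; at fixed u the square-root term vanishes as p'
    -- increases to 1, with K and L unchanged.
    have hlim : Tendsto (fun p' : ℝ => K * C * (4 ^ k * Real.Gamma (k + ν + 1)) /
        (Real.exp u / q) ^ (2 * k) * Real.exp (Real.sqrt ((1 - p') / (1 + p')) *
          ((Real.exp u / q) ^ 2 / 4) + L * w (Real.exp u))) (nhdsWithin 1 (Iio 1))
        (nhds (K * C * (4 ^ k * Real.Gamma (k + ν + 1)) /
        (Real.exp u / q) ^ (2 * k) * Real.exp (Real.sqrt ((1 - 1) / (1 + 1)) *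
          ((Real.exp u / q) ^ 2 / 4) + L * w (Real.exp u)))) := by
      refine Tendsto.mono_left ?_ nhdsWithin_le_nhds
      have hdiv : ContinuousAt (fun p' : ℝ => (1 - p') / (1 + p')) 1 :=
        ContinuousAt.div (by fun_prop) (by fun_prop) (by norm_num)
      exact (((hdiv.sqrt.mul continuousAt_const).add continuousAt_const).rexp.const_mul _ :
        ContinuousAt _ _)
    rw [sub_self, zero_div, Real.sqrt_zero, zero_mul, zero_add] at hlim
    refine ge_of_tendsto hlim ?_
    filter_upwards [Ioo_mem_nhdsLT (zero_lt_one (α := ℝ))] with p' hp'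
    have := hmain p' hp'.1 hp'.2 f (memLp_one_iff_integrable.mp hf.1) C
      (hb1.mono (hp'.2.le.trans hp)) (hb2.mono (hp'.2.le.trans hp)) k _ (hradius u hu)
    rwa [hqexp] at this
  · have hC := hb1.const_nonneg
    refine HankelHardy.ofReal_le_decayBound hν (by positivity) (by positivity) fun u hu => ?_
    rw [hlin, ← HankelHardy.coeff_bound_at_exp hq]
    have := hmain p hp0 hp1 f (memLp_one_iff_integrable.mp hf.1) C hb1 hb2 k _ (hradius u hu)
    rw [hqexp] at this
    refine this.trans ?_
    have hG := (HankelHardy.Gamma_nat_add_pos hν k).le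
    refine mul_le_mul_of_nonneg_left (Real.exp_le_exp.mpr ?_) (by positivity)
    rw [HankelHardy.zeta, mul_add]
    refine add_le_add ?_ le_rfl
    have e : Real.sqrt ((1 - p) / (1 + p)) * ((Real.exp u / q) ^ 2 / 4) =
        1 / (4 * q ^ 2) * Real.sqrt ((1 - p) / (1 + p)) * Real.exp (2 * u) := by
      rw [two_mul u, Real.exp_add]; field_simp
    rw [e]
    -- The square-root term has coefficient 1 in the estimate but L in Lζ, which is why L was taken
    -- to be at least 1.
    exact le_mul_of_one_le_left (by positivity) hL
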